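/- Let $\mathcal W$ be the partially ordered set of Weihrauch degrees of partial multi-valued functions on represented spaces, ordered by Weihrauch reducibility $\leq_{\mathrm W}$ and extended by an additional top element $\infty$. It carries the operations $\sqcap,\sqcup,\times,\star,\to$, which are well defined on degrees and are given on representatives $f:\subseteq \mathbf U\rightrightarrows \mathbf V$ and $g:\subseteq \mathbf X\rightrightarrows \mathbf Y$ as follows (composition $h\circ g$ is defined at $x$ only if $x\in\operatorname{dom}(g)$ and $g(x)\subseteq\operatorname{dom}(h)$; $\mathcal M(\mathbf Y,\mathbf Z)$ is the represented space of strongly continuous multi-valued functions $\delta_Z\circ\Phi_p\circ(\delta_Y^{\mathrm{cyl}})^{-1}$, named by $p$, where $\Phi$ is a universal machine on $\mathbb N^{\mathbb N}$ and $\delta_Y^{\mathrm{cyl}}\langle q,r\rangle=\delta_Y(q)$): * $(f\sqcup g)(0,u)=\{0\}\times f(u)$ and $(f\sqcup g)(1,x)=\{1\}\times g(x)$; * $(f\times g)(u,x)=f(u)\times g(x)$; * $(f\sqcap g)(u,x)=\{0\}\times f(u)\cup\{1\}\times g(x)$ for $(u,x)\in\operatorname{dom}(f)\times\operatorname{dom}(g)$;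 * $f\star g=(\mathrm{id}_{\mathbb N^{\mathbb N}}\times f)\circ g^{\mathrm t}$, where $g^{\mathrm t}(h,x)=(h\circ g)(x)$ for $h\in\mathcal M(\mathbf Y,\mathbb N^{\mathbb N}\times \mathbf U)$ and $x\in\mathbf X$; * if $\operatorname{dom}(g)\neq\emptyset$ or $\operatorname{dom}(f)=\emptyset$, then $(g\to f)(u)$, for $u\in\operatorname{dom}(f)$, is the set of all $(h,x)\in\mathcal M(\mathbf Y,\mathbf V)\times\mathbf X$ such that $x\in\operatorname{dom}(h\circ g)$ and $(h\circ g)(x)\subseteq f(u)$; otherwise $(g\to f)=\infty$. For the top element, $\mathbf a\sqcap\infty=\infty\sqcap\mathbf a=\mathbf a$; $\mathbf a\odot\infty=\infty\odot\mathbf a=\infty$ for $\odot\in\{\sqcup,\times,\star\}$ and all $\mathbf a$; $(\infty\to\mathbf a)=0$; and $(\mathbf a\to\infty)=\infty$ for $\mathbf a\neq\infty$. Here $0$ is the degree of the nowhere defined function and $1$ that of the identity of the one-point space. A set $\mathfrak A\subseteq\mathcal W$ is a $\star$-ideal if it is downwards closed, contains $1$, and is closed under $\star$ and $\sqcup$;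 it is a $\star$-preideal if its downwards closure $\downarrow\!\mathfrak A$ is a $\star$-ideal. A $\star$-preideal $\mathfrak A$ is etheric if for all $\mathbf a\in\,\downarrow\!\mathfrak A$ and $\mathbf b\in\mathcal W$ there is $\mathbf a'\in\,\downarrow\!\mathfrak A$ with $\mathbf a\star\mathbf b\leq_{\mathrm W}\mathbf b\star\mathbf a'$. Theorem. Let $\mathfrak A\subseteq\mathcal W$ be a $\star$-preideal, and write $\mathbf a\leq_{\mathrm W}^{\mathfrak A}\mathbf b$ if there is $\mathbf c\in\mathfrak A$ with $\mathbf a\leq_{\mathrm W}\mathbf b\star\mathbf c$. Then $\leq_{\mathrm W}^{\mathfrak A}$ is a preorder on $\mathcal W$. Let $\mathcal W/\mathfrak A$ be the partially ordered set of its equivalence classes. The operations $\sqcap$, $\sqcup$ and $\times$ induce operations on $\mathcal W/\mathfrak A$, and $\mathcal W/\mathfrak A$ is a lattice, with the induced operations $\sqcap$ as infimum and $\sqcup$ as supremum. If $\mathfrak A$ is etheric, then $\star$ and $\to$ also induce operations on $\mathcal W/\mathfrak A$. -/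

import Mathlib

/-! Weihrauch degrees: multi-valued functions on represented spaces, Weihrauch reducibility,
the operations on degrees, ideals for the compositional product and relative reducibility. -/

namespace Weihrauch

/-! ### Computability on Baire space -/

/-- Baire space. -/
abbrev Baire : Type := ℕ → ℕ

/-- The standard pairing of Baire space: `pr p q` interleaves `p` and `q`. -/
def pr (p q : Baire) : Baire := fun n => if n % 2 = 0 then p (n / 2) else q (n / 2)

/-- First component of a pair. -/
def evens (p : Baire) : Baire := fun n => p (2 * n)

/-- Second component of a pair. -/
def odds (p : Baire) : Baire := fun n => p (2 * n + 1)

theorem evens_pr (p q : Baire) : evens (pr p q) = p := by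
  funext n
  simp [evens, pr]

theorem odds_pr (p q : Baire) : odds (pr p q) = q := by
  funext n
  have h : (2 * n + 1) / 2 = n := by omega
  simp [odds, pr, h, Nat.add_mod]

/-- The list of the first `k` values of `q`. -/
def initSeg (q : Baire) (k : ℕ) : List ℕ := (List.range k).map q

/-- Code of the question "what is the `n`-th output symbol, given the input symbols in `σ`?". -/
def query (σ : List ℕ) (n : ℕ) : ℕ := Nat.pair (Encodable.encode σ) n

/-- The universal machine, with program `p` and input `q`. In order to write its `n`-th output symbol
it searches for the least `k` such that the entry of `p` at (the code of) the first `k` symbols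
of `q` and `n` is not zero, and then writes that entry minus one. The value is defined if and
only if infinitely many (that is, all) output symbols are written.
The functions `Phi p` with `p` computable are exactly the functions that are computed by
Turing machines with one-way infinite input and output tapes (with their natural domains): given a
machine, let the entry of `p` at `σ` and `n` be `m + 1` if within `σ.length` steps, and reading
only symbols in `σ`, it has written at least `n + 1` symbols, with `m` at position `n`, and `0`
otherwise. The same holds uniformly in an oracle, so `Phi` is a universal function with
the smn- and utm-properties. -/
def Phi (p q : Baire) : Part Baire :=
  ⟨∀ n, ∃ k, p (query (initSeg q k) n) ≠ 0,
    fun h n => p (query (initSeg q (Nat.find (h n))) n) - 1⟩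

/-- A partial function on Baire space is computable if some machine computes it on
its domain. -/
def IsComputable (F : Baire →. Baire) : Prop :=
  ∃ c : Baire, Computable c ∧ ∀ q, ∀ r ∈ F q, r ∈ Phi c q

/-! ### Represented spaces and multi-valued functions -/

/-- A represented space: a set with a partial surjection from Baire space. -/
structure RepSpace where
  carrier : Type
  rep : Baire →. carrier
  surj : ∀ x, ∃ p, x ∈ rep p

/-- Partial multi-valued functions; the domain is the set of points with a non-empty value. -/
abbrev MV (X Y : Type) : Type := X → Set Y

/-- The domain of a multi-valued function. -/
def MV.dom {X Y : Type} (f : MV X Y) : Set X := {x | (f x).Nonempty}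

/-- Composition `f ∘ g`: it is defined at `x` only if `x` is in the domain of `g` and all values
of `g` at `x` are in the domain of `f`. -/
def MV.comp {X Y Z : Type} (f : MV Y Z) (g : MV X Y) : MV X Z :=
  fun x => {z | (∀ y ∈ g x, y ∈ f.dom) ∧ ∃ y ∈ g x, z ∈ f y}

/-- Baire space, represented by the identity. -/
def RepSpace.baire : RepSpace where
  carrier := Baire
  rep := fun p => Part.some p
  surj := fun x => ⟨x, Part.mem_some x⟩

/-- The one-point space with a total representation. -/
def RepSpace.one : RepSpace where
  carrier := Unit
  rep := fun _ => Part.some ()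
  surj := fun x => ⟨fun _ => 0, by simp⟩

/-- The product of represented spaces. -/
def RepSpace.prod (X Y : RepSpace) : RepSpace where
  carrier := X.carrier × Y.carrier
  rep := fun p => (X.rep (evens p)).bind fun x => (Y.rep (odds p)).map fun y => (x, y)
  surj := by
    rintro ⟨x, y⟩
    obtain ⟨p, hp⟩ := X.surj x
    obtain ⟨q, hq⟩ := Y.surj y
    refine ⟨pr p q, ?_⟩
    rw [evens_pr, odds_pr]
    exact Part.mem_bind hp (Part.mem_map _ hq)

/-- `cons a p` is `p` with the symbol `a` put in front. -/
def cons (a : ℕ) (p : Baire) : Baire := fun n => Nat.casesOn n a p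

/-- The coproduct of represented spaces: names of the left points are `0p`, of the
right points `1p`. -/
def RepSpace.sum (X Y : RepSpace) : RepSpace where
  carrier := X.carrier ⊕ Y.carrier
  rep := fun p =>
    if p 0 = 0 then (X.rep fun n => p (n + 1)).map Sum.inl
    else if p 0 = 1 then (Y.rep fun n => p (n + 1)).map Sum.inr
    else Part.none
  surj := by
    rintro (x | y)
    · obtain ⟨p, hp⟩ := X.surj x
      refine ⟨cons 0 p, ?_⟩
      have h : cons 0 p 0 = 0 := rfl
      rw [if_pos h]
      exact Part.mem_map _ hp
    · obtain ⟨p, hp⟩ := Y.surj y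
      refine ⟨cons 1 p, ?_⟩
      have h : cons 1 p 0 = 1 := rfl
      rw [if_neg (by rw [h]; decide), if_pos h]
      exact Part.mem_map _ hp

/-- The multi-valued function `δ_Y ∘ Φ_p ∘ (δ_X^cyl)⁻¹`, where `δ_X^cyl ⟨q, r⟩ = δ_X q`. -/
def PhiMV (X Y : RepSpace) (p : Baire) : MV X.carrier Y.carrier :=
  fun x => {y |
    (∀ q r, x ∈ X.rep q → ∃ s ∈ Phi p (pr q r), (Y.rep s).Dom) ∧
    ∃ q r, x ∈ X.rep q ∧ ∃ s ∈ Phi p (pr q r), y ∈ Y.rep s}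

/-- The represented space of the strongly continuous multi-valued functions from `X` to `Y`. -/
def RepSpace.fn (X Y : RepSpace) : RepSpace where
  carrier := {h : MV X.carrier Y.carrier // ∃ p, h = PhiMV X Y p}
  rep := fun p => Part.some ⟨PhiMV X Y p, p, rfl⟩
  surj := by
    rintro ⟨h, p, rfl⟩
    exact ⟨p, Part.mem_some _⟩

/-- A multi-valued function on represented spaces. -/
structure Problem where
  src : RepSpace
  tgt : RepSpace
  fn : MV src.carrier tgt.carrier

/-- `F` is a realizer of `f`. -/
def Realizes (F : Baire →. Baire) (f : Problem) : Prop :=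
  ∀ p, ∀ x ∈ f.src.rep p, x ∈ f.fn.dom → ∃ q ∈ F p, ∃ y ∈ f.tgt.rep q, y ∈ f.fn x

/-- The partial function `K ⟨id, G H⟩`. -/
def sandwich (K G H : Baire →. Baire) : Baire →. Baire :=
  fun p => (H p).bind fun q => (G q).bind fun r => K (pr p r)

/-- Weihrauch reducibility of multi-valued functions. -/
def WReducible (f g : Problem) : Prop :=
  ∃ K H : Baire →. Baire, IsComputable K ∧ IsComputable H ∧
    ∀ G, Realizes G g → Realizes (sandwich K G H) f

/-! ### Operations on multi-valued functions -/

namespace Problem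

/-- The identity of Baire space. -/
def idBaire : Problem := ⟨.baire, .baire, fun p => {p}⟩

/-- The identity of the one-point space. -/
def one : Problem := ⟨.one, .one, fun x => {x}⟩

/-- A nowhere defined multi-valued function. -/
def zero : Problem := ⟨.one, .one, fun _ => ∅⟩

/-- `f ⊔ g`. -/
def join (f g : Problem) : Problem where
  src := f.src.sum g.src
  tgt := f.tgt.sum g.tgt
  fn := Sum.elim (fun x => Sum.inl '' f.fn x) (fun u => Sum.inr '' g.fn u)

/-- `f × g`. -/
def prod (f g : Problem) : Problem where
  src := f.src.prod g.src
  tgt := f.tgt.prod g.tgt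
  fn := fun z => f.fn z.1 ×ˢ g.fn z.2

/-- `f ⊓ g`, with domain `dom f × dom g`. -/
def meet (f g : Problem) : Problem where
  src := f.src.prod g.src
  tgt := f.tgt.sum g.tgt
  fn := fun z => {w | z.1 ∈ f.fn.dom ∧ z.2 ∈ g.fn.dom ∧
    w ∈ Sum.inl '' f.fn z.1 ∪ Sum.inr '' g.fn z.2}

/-- The transposition `(h, x) ↦ (h ∘ g) x` of `g`. -/
def transp (g : Problem) (U : RepSpace) : Problem where
  src := (g.tgt.fn U).prod g.src
  tgt := U
  fn := fun z => MV.comp z.1.1 g.fn z.2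

/-- The compositional product: the composition of `id × f` with the transposition of `g`. -/
def star (f g : Problem) : Problem where
  src := (g.tgt.fn (RepSpace.baire.prod f.src)).prod g.src
  tgt := RepSpace.baire.prod f.tgt
  fn := MV.comp (idBaire.prod f).fn (g.transp (RepSpace.baire.prod f.src)).fn

/-- The implication `g → f` (used where `dom g ≠ ∅` or `dom f = ∅`): at `u` it returns the
pairs `(H, x)` such that `H ∘ g` is defined at `x` with `(H ∘ g) x ⊆ f u`. Its domain is that
of `f`. -/
def impCore (g f : Problem) : Problem where
  src := f.src
  tgt := (g.tgt.fn f.tgt).prod g.src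
  fn := fun u => {z | z.2 ∈ (MV.comp z.1.1 g.fn).dom ∧ MV.comp z.1.1 g.fn z.2 ⊆ f.fn u}

end Problem

/-! ### The top element, and the operations with it -/

/-- Multi-valued functions, with an additional top element `∞`. -/
inductive ExtProblem where
  | fin (f : Problem) : ExtProblem
  | infty : ExtProblem

namespace ExtProblem

/-- Weihrauch reducibility, with `∞` above everything. -/
def Reducible : ExtProblem → ExtProblem → Prop
  | _, infty => True
  | infty, fin _ => False
  | fin f, fin g => WReducible f g

/-- `a ⊔ b`, with `a ⊔ ∞ = ∞ ⊔ a = ∞`. -/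
def join : ExtProblem → ExtProblem → ExtProblem
  | fin f, fin g => fin (f.join g)
  | infty, _ => infty
  | fin _, infty => infty

/-- `a ⊓ b`, with `a ⊓ ∞ = ∞ ⊓ a = a`. -/
def meet : ExtProblem → ExtProblem → ExtProblem
  | fin f, fin g => fin (f.meet g)
  | infty, b => b
  | fin f, infty => fin f

/-- `a × b`, with `a × ∞ = ∞ × a = ∞`. -/
def prod : ExtProblem → ExtProblem → ExtProblem
  | fin f, fin g => fin (f.prod g)
  | infty, _ => infty
  | fin _, infty => infty

/-- `a ⋆ b`, with `a ⋆ ∞ = ∞ ⋆ a = ∞`. -/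
def star : ExtProblem → ExtProblem → ExtProblem
  | fin f, fin g => fin (f.star g)
  | infty, _ => infty
  | fin _, infty => infty

open Classical in
/-- `b → a`; it is `∞` if `b` is nowhere defined and `a` is not, `∞ → a` is `0`, and `b → ∞`
is `∞` for `b ≠ ∞`. -/
noncomputable def imp : ExtProblem → ExtProblem → ExtProblem
  | infty, _ => fin Problem.zero
  | fin _, infty => infty
  | fin g, fin f =>
    if g.fn.dom.Nonempty ∨ f.fn.dom = ∅ then fin (g.impCore f) else infty

end ExtProblem

/-! ### Weihrauch reducibility is a preorder -/

/-- The universal search with bound `k`: `0` if it does not succeed. -/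
def srch (p : Baire) (τ : List ℕ) (n : ℕ) : ℕ → ℕ :=
  Nat.rec (p (query (τ.take 0) n))
    fun k v => if v = 0 then p (query (τ.take (k + 1)) n) else v

/-- The longest initial segment, of length at most `i`, of the output of the machine `q` that the input
symbols `σ` determine. -/
def outSeg (q : Baire) (σ : List ℕ) : ℕ → List ℕ :=
  Nat.rec [] fun i l =>
    if l.length = i then
      (if srch q σ i σ.length = 0 then l else l ++ [srch q σ i σ.length - 1])
    else l

theorem initSeg_take (x : Baire) {j k : ℕ} (h : j ≤ k) :
    (initSeg x k).take j = initSeg x j := by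
  simp [initSeg, ← List.map_take, List.take_range, Nat.min_eq_left h]

theorem length_initSeg (x : Baire) (k : ℕ) : (initSeg x k).length = k := by
  simp [initSeg]

theorem srch_spec (p x : Baire) (n m : ℕ) : ∀ k, k ≤ m →
    (srch p (initSeg x m) n k = 0 ∧ ∀ j ≤ k, p (query (initSeg x j) n) = 0) ∨
    (∃ j ≤ k, p (query (initSeg x j) n) ≠ 0 ∧ (∀ i < j, p (query (initSeg x i) n) = 0) ∧
      srch p (initSeg x m) n k = p (query (initSeg x j) n)) := by
  intro k
  induction k with
  | zero =>
    intro hk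
    have e : srch p (initSeg x m) n 0 = p (query (initSeg x 0) n) := by
      change p (query ((initSeg x m).take 0) n) = _
      rw [initSeg_take x hk]
    by_cases h : p (query (initSeg x 0) n) = 0
    · left
      refine ⟨by rw [e, h], fun j hj => ?_⟩
      obtain rfl : j = 0 := by omega
      exact h
    · right
      exact ⟨0, le_rfl, h, fun i hi => by omega, e⟩
  | succ k ih =>
    intro hk
    have e : srch p (initSeg x m) n (k + 1) =
        if srch p (initSeg x m) n k = 0 then p (query (initSeg x (k + 1)) n)
        else srch p (initSeg x m) n k := by
      rw [← initSeg_take x hk]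
      rfl
    rcases ih (by omega) with ⟨h0, hz⟩ | ⟨j, hj, hne, hlt, hv⟩
    · rw [if_pos h0] at e
      by_cases h : p (query (initSeg x (k + 1)) n) = 0
      · left
        refine ⟨by rw [e, h], fun j hj => ?_⟩
        rcases Nat.lt_or_ge j (k + 1) with h1 | h1
        · exact hz j (by omega)
        · obtain rfl : j = k + 1 := by omega
          exact h
      · right
        exact ⟨k + 1, le_rfl, h, fun i hi => hz i (by omega), e⟩
    · right
      refine ⟨j, by omega, hne, hlt, ?_⟩
      rw [e, if_neg (by rw [hv]; exact hne), hv]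

theorem mem_Phi_iff (p q r : Baire) : r ∈ Phi p q ↔
    ∀ n, ∃ j, p (query (initSeg q j) n) = r n + 1 ∧
      ∀ i < j, p (query (initSeg q i) n) = 0 := by
  constructor
  · rintro ⟨h, rfl⟩ n
    refine ⟨Nat.find (h n), ?_, fun i hi => ?_⟩
    · have := Nat.find_spec (h n)
      change _ = p (query (initSeg q (Nat.find (h n))) n) - 1 + 1
      omega
    · have := Nat.find_min (h n) hi
      simpa using this
  · intro h
    have hd : ∀ n, ∃ k, p (query (initSeg q k) n) ≠ 0 := fun n => by
      obtain ⟨j, hj, -⟩ := h n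
      exact ⟨j, by rw [hj]; omega⟩
    refine ⟨hd, ?_⟩
    funext n
    obtain ⟨j, hj, hlt⟩ := h n
    have e : Nat.find (hd n) = j := by
      rw [Nat.find_eq_iff]
      exact ⟨by rw [hj]; omega, fun i hi => by simp [hlt i hi]⟩
    change p (query (initSeg q (Nat.find (hd n))) n) - 1 = r n
    rw [e, hj]
    rfl

theorem srch_val {p x y : Baire} (h : y ∈ Phi p x) (n m : ℕ) :
    srch p (initSeg x m) n m = 0 ∨ srch p (initSeg x m) n m = y n + 1 := by
  obtain ⟨j, hj, hlt⟩ := (mem_Phi_iff p x y).1 h n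
  rcases srch_spec p x n m m le_rfl with ⟨h0, -⟩ | ⟨i, hi, hne, hil, hv⟩
  · exact Or.inl h0
  · right
    obtain rfl : i = j := by
      rcases lt_trichotomy i j with h1 | h1 | h1
      · exact absurd (hlt i h1) hne
      · exact h1
      · have := hil j h1
        omega
    rw [hv, hj]

theorem srch_ne {p x y : Baire} (h : y ∈ Phi p x) (n : ℕ) :
    ∃ k, ∀ m, k ≤ m → srch p (initSeg x m) n m ≠ 0 := by
  obtain ⟨j, hj, -⟩ := (mem_Phi_iff p x y).1 h n
  refine ⟨j, fun m hm h0 => ?_⟩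
  rcases srch_spec p x n m m le_rfl with ⟨-, hz⟩ | ⟨i, hi, hne, -, hv⟩
  · have := hz j hm
    omega
  · exact hne (by rw [← hv, h0])

theorem outSeg_val {q x y : Baire} (h : y ∈ Phi q x) (m : ℕ) : ∀ i,
    ∃ j ≤ i, outSeg q (initSeg x m) i = initSeg y j ∧
      ((∀ n < i, srch q (initSeg x m) n m ≠ 0) → j = i) := by
  intro i
  induction i with
  | zero => exact ⟨0, le_rfl, rfl, fun _ => rfl⟩
  | succ i ih =>
    obtain ⟨j, hj, he, hf⟩ := ih
    have e : outSeg q (initSeg x m) (i + 1) =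
        if (outSeg q (initSeg x m) i).length = i then
          (if srch q (initSeg x m) i m = 0 then outSeg q (initSeg x m) i
            else outSeg q (initSeg x m) i ++ [srch q (initSeg x m) i m - 1])
        else outSeg q (initSeg x m) i := by
      have hs : ∀ k, k = (initSeg x m).length →
          outSeg q (initSeg x m) (i + 1) =
            if (outSeg q (initSeg x m) i).length = i then
              (if srch q (initSeg x m) i k = 0 then outSeg q (initSeg x m) i
                else outSeg q (initSeg x m) i ++ [srch q (initSeg x m) i k - 1])
            else outSeg q (initSeg x m) i := by
        rintro k rfl
        rfl
      exact hs m (length_initSeg x m).symm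
    rw [he, length_initSeg] at e
    by_cases hji : j = i
    · subst hji
      rw [if_pos rfl] at e
      by_cases h0 : srch q (initSeg x m) j m = 0
      · rw [if_pos h0] at e
        exact ⟨j, by omega, e, fun hn => absurd h0 (hn j (by omega))⟩
      · rw [if_neg h0] at e
        refine ⟨j + 1, le_rfl, ?_, fun _ => rfl⟩
        rcases srch_val h j m with h1 | h1
        · exact absurd h1 h0
        · rw [e, h1]
          simp [initSeg, List.range_succ]
    · rw [if_neg hji] at e
      exact ⟨j, by omega, e, fun hn => absurd (hf fun n hn' => hn n (by omega)) hji⟩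

/-- A program for the composition of `Phi p` and `Phi q`. -/
def compProg (p q : Baire) : Baire := fun m =>
  srch p (outSeg q (Denumerable.ofNat (List ℕ) m.unpair.1)
      (Denumerable.ofNat (List ℕ) m.unpair.1).length) m.unpair.2
    (outSeg q (Denumerable.ofNat (List ℕ) m.unpair.1)
      (Denumerable.ofNat (List ℕ) m.unpair.1).length).length

theorem compProg_query (p q : Baire) (σ : List ℕ) (n : ℕ) : compProg p q (query σ n) =
    srch p (outSeg q σ σ.length) n (outSeg q σ σ.length).length := by
  simp [compProg, query]

theorem exists_uniform (P : ℕ → ℕ → Prop) (h : ∀ n, ∃ k, ∀ m, k ≤ m → P n m) (i : ℕ) :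
    ∃ k, ∀ m, k ≤ m → ∀ n < i, P n m := by
  induction i with
  | zero => exact ⟨0, fun m _ n hn => by omega⟩
  | succ i ih =>
    obtain ⟨k, hk⟩ := ih
    obtain ⟨l, hl⟩ := h i
    refine ⟨max k l, fun m hm n hn => ?_⟩
    rcases Nat.lt_or_ge n i with h1 | h1
    · exact hk m (by omega) n h1
    · obtain rfl : n = i := by omega
      exact hl m (by omega)

theorem mem_Phi_compProg {p q x y z : Baire} (hy : y ∈ Phi q x) (hz : z ∈ Phi p y) :
    z ∈ Phi (compProg p q) x := by
  have hval : ∀ n k, compProg p q (query (initSeg x k) n) = 0 ∨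
      compProg p q (query (initSeg x k) n) = z n + 1 := fun n k => by
    rw [compProg_query, length_initSeg]
    obtain ⟨j, -, he, -⟩ := outSeg_val hy k k
    rw [he, length_initSeg]
    exact srch_val hz n j
  have hne : ∀ n, ∃ k, compProg p q (query (initSeg x k) n) ≠ 0 := fun n => by
    obtain ⟨K, hK⟩ := srch_ne hz n
    obtain ⟨L, hL⟩ := exists_uniform _ (fun i => srch_ne hy i) K
    -- the output of the first machine need not be known up to `k`, only up to `K`
    refine ⟨max K L, ?_⟩
    rw [compProg_query, length_initSeg]
    obtain ⟨j, -, he, -⟩ := outSeg_val hy (max K L) (max K L)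
    rw [he, length_initSeg]
    apply hK
    -- `K ≤ j`, since the segment only grows
    have mono : ∀ i, K ≤ i →
        K ≤ (outSeg q (initSeg x (max K L)) i).length := by
      intro i hi
      induction i, hi using Nat.le_induction with
      | base =>
        obtain ⟨j', -, he', hf'⟩ := outSeg_val hy (max K L) K
        rw [he', length_initSeg, hf' (hL _ (le_max_right _ _))]
      | succ i hi ih =>
        have e : outSeg q (initSeg x (max K L)) (i + 1) =
            if (outSeg q (initSeg x (max K L)) i).length = i then
              (if srch q (initSeg x (max K L)) i (initSeg x (max K L)).length = 0
                then outSeg q (initSeg x (max K L)) i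
                else outSeg q (initSeg x (max K L)) i ++
                  [srch q (initSeg x (max K L)) i (initSeg x (max K L)).length - 1])
            else outSeg q (initSeg x (max K L)) i := rfl
        rw [e]
        split_ifs
        · exact ih
        · rw [List.length_append]
          omega
        · exact ih
    have := mono (max K L) (le_max_left _ _)
    rwa [he, length_initSeg] at this
  rw [mem_Phi_iff]
  intro n
  refine ⟨Nat.find (hne n), ?_, fun i hi => ?_⟩
  · exact (hval n _).resolve_left (Nat.find_spec (hne n))
  · simpa using Nat.find_min (hne n) hi

theorem computable_query {α : Type} [Primcodable α] {f : α → List ℕ} {g : α → ℕ}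
    (hf : Computable f) (hg : Computable g) : Computable fun a => query (f a) (g a) :=
  (Primrec₂.natPair.to_comp).comp (Computable.encode.comp hf) hg

theorem computable_srch {p : Baire} (hp : Computable p) {α : Type} [Primcodable α]
    {f : α → List ℕ} {g k : α → ℕ} (hf : Computable f) (hg : Computable g)
    (hk : Computable k) : Computable fun a => srch p (f a) (g a) (k a) := by
  refine Computable.nat_rec (f := k) (g := fun a => p (query ((f a).take 0) (g a)))
    (h := fun a z => if z.2 = 0 then p (query ((f a).take (z.1 + 1)) (g a)) else z.2) hk ?_ ?_
  · exact hp.comp (computable_query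
      ((Primrec.list_take.to_comp).comp (Computable.const 0) hf) hg)
  · have hz : Computable fun w : α × ℕ × ℕ => w.2.2 := Computable.snd.comp Computable.snd
    have h1 : Computable fun w : α × ℕ × ℕ =>
        p (query ((f w.1).take (w.2.1 + 1)) (g w.1)) :=
      hp.comp (computable_query ((Primrec.list_take.to_comp).comp
        (Computable.succ.comp (Computable.fst.comp Computable.snd))
        (hf.comp Computable.fst)) (hg.comp Computable.fst))
    have h2 := Computable.nat_casesOn (h := fun (w : α × ℕ × ℕ) (_ : ℕ) => w.2.2) hz h1
      (hz.comp Computable.fst)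
    refine h2.of_eq fun w => ?_
    rcases h : w.2.2 with _ | v <;> simp [h]

theorem computable_outSeg {q : Baire} (hq : Computable q) {α : Type} [Primcodable α]
    {f : α → List ℕ} {k : α → ℕ} (hf : Computable f)
    (hk : Computable k) : Computable fun a => outSeg q (f a) (k a) := by
  refine Computable.nat_rec (f := k) (g := fun _ => ([] : List ℕ))
    (h := fun a z => if z.2.length = z.1 then
      (if srch q (f a) z.1 (f a).length = 0 then z.2
        else z.2 ++ [srch q (f a) z.1 (f a).length - 1]) else z.2) hk (Computable.const _) ?_
  have hl : Computable fun w : α × ℕ × List ℕ => w.2.2 := Computable.snd.comp Computable.snd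
  have hi : Computable fun w : α × ℕ × List ℕ => w.2.1 := Computable.fst.comp Computable.snd
  have hσ : Computable fun w : α × ℕ × List ℕ => f w.1 := hf.comp Computable.fst
  have hs : Computable fun w : α × ℕ × List ℕ => srch q (f w.1) w.2.1 (f w.1).length :=
    computable_srch hq hσ hi (Computable.list_length.comp hσ)
  have hc : Computable fun w : α × ℕ × List ℕ => decide (w.2.2.length = w.2.1) :=
    (Primrec.eq.decide.to_comp).comp (Computable.list_length.comp hl) hi
  have hin := Computable.nat_casesOn
    (h := fun (w : α × ℕ × List ℕ) (v : ℕ) => w.2.2 ++ [v]) hs hl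
    (Computable.list_concat.comp (hl.comp Computable.fst) Computable.snd)
  refine (Computable.cond hc hin hl).of_eq fun w => ?_
  by_cases h1 : w.2.2.length = w.2.1
  · rcases h : srch q (f w.1) w.2.1 (f w.1).length with _ | v <;> simp [h1, h]
  · simp [h1]

theorem computable_compProg {p q : Baire} (hp : Computable p) (hq : Computable q) :
    Computable (compProg p q) := by
  have hσ : Computable fun m : ℕ => Denumerable.ofNat (List ℕ) m.unpair.1 :=
    (Computable.ofNat _).comp (Computable.fst.comp Computable.unpair)
  have ho := computable_outSeg hq hσ (Computable.list_length.comp hσ)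
  exact computable_srch hp ho (Computable.snd.comp Computable.unpair)
    (Computable.list_length.comp ho)

theorem IsComputable.comp {F G : Baire →. Baire} (hF : IsComputable F) (hG : IsComputable G) :
    IsComputable fun x => (G x).bind F := by
  obtain ⟨p, hp, hpF⟩ := hF
  obtain ⟨q, hq, hqG⟩ := hG
  refine ⟨compProg p q, computable_compProg hp hq, fun x z hz => ?_⟩
  obtain ⟨y, hy, hz⟩ := Part.mem_bind_iff.1 hz
  exact mem_Phi_compProg (hqG x y hy) (hpF y z hz)

/-- A program that looks up the `e n`-th input symbol as its `n`-th output symbol. -/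
theorem isComputable_lookup {e : ℕ → ℕ} (he : Computable e) :
    IsComputable fun x => Part.some fun n => x (e n) := by
  refine ⟨fun m => Option.casesOn
    ((Denumerable.ofNat (List ℕ) m.unpair.1)[e m.unpair.2]?) 0 Nat.succ, ?_, ?_⟩
  · refine Computable.option_casesOn (g := fun _ v => Nat.succ v) ?_ (Computable.const 0)
      (Computable.succ.comp Computable.snd).to₂
    exact Computable.list_getElem?.comp
      ((Computable.ofNat _).comp (Computable.fst.comp Computable.unpair))
      (he.comp (Computable.snd.comp Computable.unpair))
  · intro x r hr
    rw [Part.mem_some_iff] at hr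
    subst hr
    rw [mem_Phi_iff]
    intro n
    refine ⟨e n + 1, ?_, fun i hi => ?_⟩
    · simp [query, initSeg]
    · have : (initSeg x i)[e n]? = none := by
        rw [List.getElem?_eq_none_iff, length_initSeg]
        omega
      simp [query, this]

theorem IsComputable.pair {F G : Baire →. Baire} (hF : IsComputable F) (hG : IsComputable G) :
    IsComputable fun x => (F x).bind fun a => (G x).map fun b => pr a b := by
  obtain ⟨p, hp, hpF⟩ := hF
  obtain ⟨q, hq, hqG⟩ := hG
  have hn : Computable fun m : ℕ => Nat.pair m.unpair.1 (m.unpair.2 / 2) :=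
    (Primrec₂.natPair.to_comp).comp (Computable.fst.comp Computable.unpair)
      ((Primrec.nat_div.to_comp).comp (Computable.snd.comp Computable.unpair)
        (Computable.const 2))
  have hc : Computable fun m : ℕ => decide (m.unpair.2 % 2 = 0) :=
    (Primrec.eq.decide.to_comp).comp ((Primrec.nat_mod.to_comp).comp
      (Computable.snd.comp Computable.unpair) (Computable.const 2)) (Computable.const 0)
  refine ⟨_, Computable.cond hc (hp.comp hn) (hq.comp hn), fun x r hr => ?_⟩
  obtain ⟨a, ha, hr⟩ := Part.mem_bind_iff.1 hr
  obtain ⟨b, hb, rfl⟩ := (Part.mem_map_iff _).1 hr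
  have ha' := (mem_Phi_iff _ _ _).1 (hpF x a ha)
  have hb' := (mem_Phi_iff _ _ _).1 (hqG x b hb)
  rw [mem_Phi_iff]
  intro n
  by_cases h : n % 2 = 0
  · simpa [query, pr, h] using ha' (n / 2)
  · simpa [query, pr, h] using hb' (n / 2)

theorem isComputable_evens : IsComputable fun x => Part.some (evens x) :=
  isComputable_lookup ((Primrec.nat_mul.to_comp).comp (Computable.const 2) Computable.id)

theorem isComputable_odds : IsComputable fun x => Part.some (odds x) :=
  isComputable_lookup (Computable.succ.comp
    ((Primrec.nat_mul.to_comp).comp (Computable.const 2) Computable.id))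

theorem isComputable_id : IsComputable fun x => Part.some x :=
  isComputable_lookup Computable.id

theorem WReducible.refl (f : Problem) : WReducible f f := by
  refine ⟨_, _, isComputable_odds, isComputable_id, fun G hG p x hx hd => ?_⟩
  obtain ⟨q, hq, y, hy, hyf⟩ := hG p x hx hd
  refine ⟨q, ?_, y, hy, hyf⟩
  refine Part.mem_bind (Part.mem_some p) (Part.mem_bind hq ?_)
  change q ∈ Part.some (odds (pr p q))
  rw [odds_pr]
  exact Part.mem_some q

theorem WReducible.trans {f g h : Problem} (hfg : WReducible f g) (hgh : WReducible g h) :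
    WReducible f h := by
  obtain ⟨K, H, hK, hH, hr⟩ := hfg
  obtain ⟨K', H', hK', hH', hr'⟩ := hgh
  refine ⟨_, _, hK.comp (isComputable_evens.pair
    (hK'.comp ((hH.comp isComputable_evens).pair isComputable_odds))), hH'.comp hH,
    fun G hG p x hx hd => ?_⟩
  obtain ⟨q, hq, y, hy, hyf⟩ := hr _ (hr' G hG) p x hx hd
  refine ⟨q, ?_, y, hy, hyf⟩
  obtain ⟨a, ha, hq⟩ := Part.mem_bind_iff.1 hq
  obtain ⟨b, hb, hq⟩ := Part.mem_bind_iff.1 hq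
  obtain ⟨c, hc, hb⟩ := Part.mem_bind_iff.1 hb
  obtain ⟨d, hd', hb⟩ := Part.mem_bind_iff.1 hb
  refine Part.mem_bind (Part.mem_bind ha hc) (Part.mem_bind hd' ?_)
  have h1 : pr a d ∈ ((Part.some (evens (pr p d))).bind H).bind fun u =>
      (Part.some (odds (pr p d))).map fun v => pr u v := by
    rw [evens_pr, odds_pr]
    exact Part.mem_bind (Part.mem_bind (Part.mem_some _) ha) (Part.mem_map _ (Part.mem_some _))
  have h2 : pr p b ∈ (Part.some (evens (pr p d))).bind fun u =>
      ((((Part.some (evens (pr p d))).bind H).bind fun u =>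
        (Part.some (odds (pr p d))).map fun v => pr u v).bind K').map fun v => pr u v := by
    refine Part.mem_bind (a := p) ?_ (Part.mem_map _ (Part.mem_bind h1 hb))
    rw [evens_pr]
    exact Part.mem_some p
  exact Part.mem_bind h2 hq

/-- Weihrauch reducibility as a preorder; `a ≤ b` is `a ≤_W b`. -/
instance : Preorder ExtProblem where
  le := ExtProblem.Reducible
  le_refl a := by
    cases a with
    | fin f => exact WReducible.refl f
    | infty => trivial
  le_trans a b c hab hbc := by
    cases c with
    | infty => cases a <;> trivial
    | fin h =>
      cases b with
      | infty => exact hbc.elim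
      | fin g =>
        cases a with
        | infty => exact hab.elim
        | fin f => exact WReducible.trans hab hbc

/-! ### Weihrauch degrees -/

/-- The partially ordered set of Weihrauch degrees. -/
abbrev Degree : Type 1 := Antisymmetrization ExtProblem (· ≤ ·)

/-- The degree of a multi-valued function (or of `∞`). -/
def deg (f : ExtProblem) : Degree := toAntisymmetrization (· ≤ ·) f

/-- A representative of a degree. -/
noncomputable def rp (a : Degree) : ExtProblem := ofAntisymmetrization (· ≤ ·) a

theorem deg_rp (a : Degree) : deg (rp a) = a :=
  toAntisymmetrization_ofAntisymmetrization _ a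

/-- `a ⊔ b` on degrees. -/
noncomputable def dJoin (a b : Degree) : Degree := deg ((rp a).join (rp b))

/-- `a ⊓ b` on degrees. -/
noncomputable def dMeet (a b : Degree) : Degree := deg ((rp a).meet (rp b))

/-- `a × b` on degrees. -/
noncomputable def dProd (a b : Degree) : Degree := deg ((rp a).prod (rp b))

/-- `a ⋆ b` on degrees. -/
noncomputable def dStar (a b : Degree) : Degree := deg ((rp a).star (rp b))

/-- `a → b` on degrees. -/
noncomputable def dImp (a b : Degree) : Degree := deg ((rp a).imp (rp b))

/-- The degree `1`. -/
def dOne : Degree := deg (.fin Problem.one)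

/-! ### Ideals and relative reducibility -/

/-- Ideals for the compositional product. -/
structure IsStarIdeal (A : Set Degree) : Prop where
  lower : ∀ a ∈ A, ∀ b, b ≤ a → b ∈ A
  one_mem : dOne ∈ A
  star_mem : ∀ a ∈ A, ∀ b ∈ A, dStar a b ∈ A
  join_mem : ∀ a ∈ A, ∀ b ∈ A, dJoin a b ∈ A

/-- Sets whose downwards closure is an ideal. -/
def IsStarPreideal (A : Set Degree) : Prop :=
  IsStarIdeal (lowerClosure A : Set Degree)

/-- A preideal is etheric if for all `a` in its downwards closure and all `b` there is `a'` in its downwards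
closure with `a ⋆ b ≤ b ⋆ a'`. -/
def IsEtheric (A : Set Degree) : Prop :=
  ∀ a ∈ lowerClosure A, ∀ b : Degree, ∃ a' ∈ lowerClosure A, dStar a b ≤ dStar b a'

/-- Weihrauch reducibility relative to `A`. -/
def LeMod (A : Set Degree) (a b : Degree) : Prop := ∃ c ∈ A, a ≤ dStar b c

/-- The binary operation `op` on degrees induces the operation `op'` on the quotient by the
equivalence relation of the relation `r`. -/
def Induces (r : Degree → Degree → Prop) [IsPreorder Degree r] (op : Degree → Degree → Degree)
    (op' : Antisymmetrization Degree r → Antisymmetrization Degree r →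
      Antisymmetrization Degree r) : Prop :=
  ∀ a b, op' (toAntisymmetrization r a) (toAntisymmetrization r b) =
    toAntisymmetrization r (op a b)

end Weihrauch

namespace Weihrauch

/-! ### Computable functions on subsets of Baire space -/

/-! A multi-valued function on represented spaces is replaced by `names f`, the problem it poses on
names. Weihrauch reducibility then becomes `Red` (`wReducible_iff_red`): a map `H` on instances and
a map `K` on pairs of an instance and a solution, each computable on the set where it is needed. The
operations on problems turn into explicit ones on Baire space (`names_star`, `names_impCore` and
their companions).

The central tool is `red_star_iff`: `k` lies below `f ⋆ g` exactly if some computable `H` turns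
instances of `k` into instances of `g` such that the residual problem, to solve `k` once `H p` has
been solved, lies below `f`. Only its proof and that of the residuation law handle programs; they
rest on the utm- and smn-properties of `Phi` (`compOn_ev`, `CompOn.exists_smn`). It yields
monotonicity and associativity of `⋆`, the interchange law `(a ⋆ c) × (b ⋆ d) ≤ (a × b) ⋆ (c × d)`,
and the fact that `k ≤ a ⋆ c` and `k ≤ b ⋆ c` imply `k ≤ (a ⊓ b) ⋆ (c × c)`. The residuation law `a
→ b ≤ x ↔ b ≤ a ⋆ x` is `red_imp_iff`, extended to `∞` in `imp_le_iff`.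

The rest is algebra of degrees. Associativity and closure of the ideal under `⋆` give transitivity.
Closure under `⊔` provides common advice for two reductions, which gives suprema and, with `c × c`,
infima; interchange handles `×`. For `⋆` an advice `c` gets stuck in `a ⋆ c ⋆ b`, and ethericity
moves it to the right of `b`. Residuation reduces `→` to the same manoeuvre. -/

/-- The total function `φ` is computable on the set `D`. -/
def CompOn (D : Set Baire) (φ : Baire → Baire) : Prop :=
  ∃ c : Baire, Computable c ∧ ∀ p ∈ D, φ p ∈ Phi c p

open Classical in
/-- The value of the universal machine, with a default value where it is undefined. -/
noncomputable def ev (e x : Baire) : Baire :=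
  if h : (Phi e x).Dom then (Phi e x).get h else fun _ => 0

theorem ev_mem {e x : Baire} (h : (Phi e x).Dom) : ev e x ∈ Phi e x := by
  rw [ev, dif_pos h]
  exact Part.get_mem h

theorem ev_eq {e x y : Baire} (h : y ∈ Phi e x) : ev e x = y :=
  Part.mem_unique (ev_mem (Part.dom_iff_mem.2 ⟨y, h⟩)) h

/-- The machine commits to the first entry that is not zero. If no entry is ever wrong and some
entry is not zero, the first such entry is right, so the answers need not be monotone in the length
of the input. -/
theorem mem_Phi_of_approx {p q y : Baire}
    (h : ∀ n, (∀ m, p (query (initSeg q m) n) = 0 ∨ p (query (initSeg q m) n) = y n + 1) ∧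
      ∃ m, p (query (initSeg q m) n) ≠ 0) : y ∈ Phi p q := by
  rw [mem_Phi_iff]
  intro n
  obtain ⟨hv, hne⟩ := h n
  refine ⟨Nat.find hne, (hv _).resolve_left (Nat.find_spec hne), fun i hi => ?_⟩
  simpa using Nat.find_min hne hi

theorem compOn_of_approx {D : Set Baire} {φ : Baire → Baire} (A : List ℕ → ℕ → ℕ)
    (hA : Computable fun z : List ℕ × ℕ => A z.1 z.2)
    (h : ∀ p ∈ D, ∀ n, (∀ m, A (initSeg p m) n = 0 ∨ A (initSeg p m) n = φ p n + 1) ∧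
      ∃ m, A (initSeg p m) n ≠ 0) : CompOn D φ := by
  refine ⟨fun m => A (Denumerable.ofNat (List ℕ) m.unpair.1) m.unpair.2, ?_, fun p hp => ?_⟩
  · exact hA.comp (((Computable.ofNat _).comp (Computable.fst.comp Computable.unpair)).pair
      (Computable.snd.comp Computable.unpair))
  · refine mem_Phi_of_approx fun n => ?_
    simpa [query] using h p hp n

theorem CompOn.congr {D : Set Baire} {φ ψ : Baire → Baire} (h : CompOn D φ)
    (e : ∀ p ∈ D, ψ p = φ p) : CompOn D ψ := by
  obtain ⟨c, hc, h⟩ := h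
  exact ⟨c, hc, fun p hp => by rw [e p hp]; exact h p hp⟩

theorem CompOn.mono {D E : Set Baire} {φ : Baire → Baire} (h : CompOn E φ) (hD : D ⊆ E) :
    CompOn D φ := by
  obtain ⟨c, hc, h⟩ := h
  exact ⟨c, hc, fun p hp => h p (hD hp)⟩

theorem IsComputable.compOn {D : Set Baire} {F : Baire →. Baire} {φ : Baire → Baire}
    (h : IsComputable F) (e : ∀ p ∈ D, φ p ∈ F p) : CompOn D φ := by
  obtain ⟨c, hc, h⟩ := h
  exact ⟨c, hc, fun p hp => h p _ (e p hp)⟩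

theorem CompOn.comp {D E : Set Baire} {φ ψ : Baire → Baire} (hψ : CompOn E ψ)
    (hφ : CompOn D φ) (h : ∀ p ∈ D, φ p ∈ E) : CompOn D fun p => ψ (φ p) := by
  obtain ⟨c, hc, hφ⟩ := hφ
  obtain ⟨d, hd, hψ⟩ := hψ
  exact ⟨_, computable_compProg hd hc, fun p hp =>
    mem_Phi_compProg (hφ p hp) (hψ _ (h p hp))⟩

theorem CompOn.pr {D : Set Baire} {φ ψ : Baire → Baire} (hφ : CompOn D φ)
    (hψ : CompOn D ψ) : CompOn D fun p => pr (φ p) (ψ p) := by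
  obtain ⟨c, hc, hφ⟩ := hφ
  obtain ⟨d, hd, hψ⟩ := hψ
  have h := IsComputable.pair (F := Phi c) (G := Phi d) ⟨c, hc, fun _ _ h => h⟩
    ⟨d, hd, fun _ _ h => h⟩
  exact h.compOn fun p hp => Part.mem_bind (hφ p hp) (Part.mem_map _ (hψ p hp))

theorem CompOn.id {D : Set Baire} : CompOn D fun p => p :=
  isComputable_id.compOn fun p _ => Part.mem_some p

theorem CompOn.evens {D : Set Baire} {φ : Baire → Baire} (hφ : CompOn D φ) :
    CompOn D fun p => evens (φ p) :=
  CompOn.comp (E := Set.univ) (isComputable_evens.compOn fun _ _ => Part.mem_some _) hφ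
    fun _ _ => trivial

theorem CompOn.odds {D : Set Baire} {φ : Baire → Baire} (hφ : CompOn D φ) :
    CompOn D fun p => odds (φ p) :=
  CompOn.comp (E := Set.univ) (isComputable_odds.compOn fun _ _ => Part.mem_some _) hφ
    fun _ _ => trivial

/-- The sequence without its first symbol. -/
def tail (p : Baire) : Baire := fun n => p (n + 1)

theorem tail_cons (a : ℕ) (p : Baire) : tail (cons a p) = p := rfl

theorem CompOn.tail {D : Set Baire} {φ : Baire → Baire} (hφ : CompOn D φ) :
    CompOn D fun p => tail (φ p) :=
  CompOn.comp (E := Set.univ)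
    ((isComputable_lookup Computable.succ).compOn fun _ _ => Part.mem_some _) hφ
    fun _ _ => trivial

theorem CompOn.const {D : Set Baire} {r : Baire} (hr : Computable r) :
    CompOn D fun _ => r := by
  refine compOn_of_approx (fun _ n => r n + 1)
    (Computable.succ.comp (hr.comp Computable.snd)) fun p _ n => ?_
  exact ⟨fun m => Or.inr rfl, 0, by simp⟩

theorem CompOn.zero {D : Set Baire} : CompOn D fun _ => fun _ => 0 :=
  CompOn.const (Computable.const 0)

theorem getElem?_initSeg (x : Baire) {i m : ℕ} (h : i < m) :
    (initSeg x m)[i]? = some (x i) := by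
  simp [initSeg, h]

theorem getElem?_initSeg_of_le (x : Baire) {i m : ℕ} (h : m ≤ i) :
    (initSeg x m)[i]? = none := by
  rw [List.getElem?_eq_none_iff, length_initSeg]
  exact h

theorem CompOn.cons {D : Set Baire} {φ : Baire → Baire} (a : ℕ) (hφ : CompOn D φ) :
    CompOn D fun p => cons a (φ p) := by
  refine CompOn.comp (E := Set.univ) (ψ := Weihrauch.cons a) ?_ hφ fun _ _ => trivial
  refine compOn_of_approx (fun τ n => Nat.casesOn n (a + 1) fun i =>
    Option.casesOn τ[i]? 0 Nat.succ) ?_ fun p _ n => ?_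
  · refine Computable.nat_casesOn (h := fun (z : List ℕ × ℕ) i =>
      (Option.casesOn z.1[i]? 0 Nat.succ : ℕ)) Computable.snd (Computable.const _) ?_
    refine Computable.option_casesOn (g := fun _ v => Nat.succ v) ?_ (Computable.const 0)
      (Computable.succ.comp Computable.snd).to₂
    exact Computable.list_getElem?.comp (Computable.fst.comp Computable.fst) Computable.snd
  · rcases n with _ | i
    · exact ⟨fun m => Or.inr rfl, 0, by simp⟩
    · refine ⟨fun m => ?_, i + 1, ?_⟩
      · rcases Nat.lt_or_ge i m with h | h
        · right
          simp only [getElem?_initSeg p h]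
          rfl
        · left
          simp only [getElem?_initSeg_of_le p h]
      · simp only [getElem?_initSeg p (Nat.lt_succ_self i)]
        simp

/-- Each branch is computable only on its own part of `D`, so the two cannot both be evaluated and
compared; the test symbol has to be read before a branch is started. -/
theorem CompOn.ite {D : Set Baire} {φ ψ χ : Baire → Baire} (hφ : CompOn D φ)
    (hψ : CompOn {p | p ∈ D ∧ φ p 0 = 0} ψ) (hχ : CompOn {p | p ∈ D ∧ φ p 0 ≠ 0} χ) :
    CompOn D fun p => if φ p 0 = 0 then ψ p else χ p := by
  obtain ⟨c, hc, hψ⟩ := hψ.comp (D := {x | Weihrauch.odds x ∈ D ∧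
    Weihrauch.evens x = φ (Weihrauch.odds x) ∧ x 0 = 0})
    CompOn.id.odds fun p hp => ⟨hp.1, by rw [← hp.2.1]; exact hp.2.2⟩
  obtain ⟨d, hd, hχ⟩ := hχ.comp (D := {x | Weihrauch.odds x ∈ D ∧
    Weihrauch.evens x = φ (Weihrauch.odds x) ∧ x 0 ≠ 0})
    CompOn.id.odds fun p hp => ⟨hp.1, by rw [← hp.2.1]; exact hp.2.2⟩
  -- On the input `pr (φ p) p` the test symbol is symbol `0`. With an empty prefix the program
  -- answers `0`; afterwards it simulates the machine that this symbol selects.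
  have key : CompOn {x | Weihrauch.odds x ∈ D ∧ Weihrauch.evens x = φ (Weihrauch.odds x)}
      fun x => if x 0 = 0 then ψ (Weihrauch.odds x) else χ (Weihrauch.odds x) := by
    refine compOn_of_approx (fun τ n => Option.casesOn τ[0]? 0 fun v =>
      Nat.casesOn v (srch c τ n τ.length) fun _ => srch d τ n τ.length) ?_ fun p hp n => ?_
    · have hs : ∀ {c : Baire}, Computable c → Computable
          fun z : (List ℕ × ℕ) × ℕ => srch c z.1.1 z.1.2 z.1.1.length := fun hc =>
        computable_srch hc (Computable.fst.comp Computable.fst)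
          (Computable.snd.comp Computable.fst)
          (Computable.list_length.comp (Computable.fst.comp Computable.fst))
      refine Computable.option_casesOn (g := fun (z : List ℕ × ℕ) v =>
        (Nat.casesOn v (srch c z.1 z.2 z.1.length) fun _ => srch d z.1 z.2 z.1.length : ℕ))
        (Computable.list_getElem?.comp Computable.fst (Computable.const 0))
        (Computable.const 0) ?_
      exact Computable.nat_casesOn (h := fun (z : (List ℕ × ℕ) × ℕ) _ =>
        srch d z.1.1 z.1.2 z.1.1.length) Computable.snd (hs hc)
        ((hs hd).comp Computable.fst).to₂
    · have h0 : (initSeg p 0)[0]? = none := getElem?_initSeg_of_le p le_rfl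
      have h1 : ∀ m, (initSeg p (m + 1))[0]? = some (p 0) := fun m =>
        getElem?_initSeg p (by omega)
      by_cases hz : p 0 = 0
      · have hy := hψ p ⟨hp.1, hp.2, hz⟩
        rw [if_pos hz]
        refine ⟨fun m => ?_, ?_⟩
        · rcases m with _ | m
          · left
            simp only [h0]
          · simp only [h1, hz, length_initSeg]
            exact srch_val hy n (m + 1)
        · obtain ⟨k, hk⟩ := srch_ne hy n
          refine ⟨k + 1, ?_⟩
          simp only [h1, hz, length_initSeg]
          exact hk _ (by omega)
      · have hy := hχ p ⟨hp.1, hp.2, hz⟩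
        rw [if_neg hz]
        obtain ⟨v, hv⟩ := Nat.exists_eq_succ_of_ne_zero hz
        refine ⟨fun m => ?_, ?_⟩
        · rcases m with _ | m
          · left
            simp only [h0]
          · simp only [h1, hv, length_initSeg]
            exact srch_val hy n (m + 1)
        · obtain ⟨k, hk⟩ := srch_ne hy n
          refine ⟨k + 1, ?_⟩
          simp only [h1, hv, length_initSeg]
          exact hk _ (by omega)
  refine (key.comp (hφ.pr CompOn.id) fun p hp => ?_).congr fun p _ => ?_
  · simp only [Set.mem_ofPred_eq, evens_pr, odds_pr]
    exact ⟨hp, trivial⟩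
  · simp only [odds_pr]
    rfl

/-! ### The universal machine is computable, and programs can be computed -/

theorem initSeg_congr {x y : Baire} {k : ℕ} (h : ∀ i < k, x i = y i) :
    initSeg x k = initSeg y k :=
  List.map_congr_left fun i hi => h i (List.mem_range.1 hi)

/-- The sequence that continues `τ` by zeros. -/
def pad (τ : List ℕ) : Baire := fun i => τ.getD i 0

theorem pad_initSeg (x : Baire) {i m : ℕ} (h : i < m) : pad (initSeg x m) i = x i := by
  simp [pad, initSeg, h]

theorem primrec_pad {α : Type} [Primcodable α] {f : α → List ℕ} {g : α → ℕ}
    (hf : Primrec f) (hg : Primrec g) : Primrec fun a => pad (f a) (g a) :=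
  (Primrec.list_getD 0).comp hf hg

theorem primrec_initSeg {α : Type} [Primcodable α] {f : α → Baire} {g : α → ℕ}
    (hf : Primrec₂ f) (hg : Primrec g) : Primrec fun a => initSeg (f a) (g a) :=
  Primrec.list_map (Primrec.list_range.comp hg) hf

theorem primrec_query {α : Type} [Primcodable α] {f : α → List ℕ} {g : α → ℕ}
    (hf : Primrec f) (hg : Primrec g) : Primrec fun a => query (f a) (g a) :=
  Primrec₂.natPair.comp (Primrec.encode.comp hf) hg

/-- The universal search, given the finite part `τ` of a program and its input: `0` if the
entries with index below the bound are known and zero, `1` if one of them is not known,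
`v + 1` if `v` is the first entry that is not zero. -/
def univSearch (τ : List ℕ) (n : ℕ) : ℕ → ℕ :=
  Nat.rec 0 fun k z => Nat.casesOn z
    (Option.casesOn τ[2 * query (initSeg (odds (pad τ)) k) n]? 1 fun v =>
      Nat.casesOn v 0 fun w => w + 2) Nat.succ

theorem primrec_univSearch : Primrec fun z : List ℕ × ℕ =>
    univSearch z.1 z.2 (z.1.length / 2 + 1) := by
  refine Primrec.nat_rec' (f := fun z : List ℕ × ℕ => z.1.length / 2 + 1) (g := fun _ => 0)
    (h := fun z w => Nat.casesOn w.2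
      (Option.casesOn z.1[2 * query (initSeg (odds (pad z.1)) w.1) z.2]? 1 fun v =>
        Nat.casesOn v 0 fun w => w + 2) Nat.succ) ?_ (Primrec.const 0) ?_
  · exact Primrec.succ.comp (Primrec.nat_div.comp (Primrec.list_length.comp Primrec.fst)
      (Primrec.const 2))
  · refine Primrec.nat_casesOn (f := fun u : (List ℕ × ℕ) × ℕ × ℕ => u.2.2)
      (h := fun _ i => i + 1) (Primrec.snd.comp Primrec.snd) ?_
      (Primrec.succ.comp Primrec.snd).to₂
    refine Primrec.option_casesOn (o := fun u : (List ℕ × ℕ) × ℕ × ℕ =>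
      u.1.1[2 * query (initSeg (odds (pad u.1.1)) u.2.1) u.1.2]?) (f := fun _ => 1)
      (g := fun _ v => Nat.casesOn v 0 fun w => w + 2) ?_ (Primrec.const 1) ?_
    · refine Primrec.list_getElem?.comp (Primrec.fst.comp Primrec.fst)
        (Primrec.nat_mul.comp (Primrec.const 2) (primrec_query (primrec_initSeg ?_
          (Primrec.fst.comp Primrec.snd)) (Primrec.snd.comp Primrec.fst)))
      exact primrec_pad (Primrec.fst.comp (Primrec.fst.comp Primrec.fst))
        (Primrec.succ.comp (Primrec.nat_mul.comp (Primrec.const 2) Primrec.snd))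
    · exact Primrec.nat_casesOn (f := fun u : ((List ℕ × ℕ) × ℕ × ℕ) × ℕ => u.2)
        (g := fun _ => 0) (h := fun _ w => w + 2) Primrec.snd (Primrec.const 0)
        (Primrec.succ.comp (Primrec.succ.comp Primrec.snd)).to₂

theorem initSeg_odds_pad (x : Baire) {k m : ℕ} (h : k ≤ m / 2) :
    initSeg (odds (pad (initSeg x m))) k = initSeg (odds x) k :=
  initSeg_congr fun i hi => pad_initSeg x (by omega)

theorem univSearch_succ (x : Baire) (n : ℕ) {m K : ℕ} (h : K ≤ m / 2) :
    univSearch (initSeg x m) n (K + 1) =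
      Nat.casesOn (univSearch (initSeg x m) n K)
        (Option.casesOn (initSeg x m)[2 * query (initSeg (odds x) K) n]? 1 fun v =>
          Nat.casesOn v 0 fun w => w + 2) Nat.succ := by
  rw [← initSeg_odds_pad x h]
  rfl

/-- The search has either met only known zero entries, or been blocked by an entry beyond the
prefix, or found the right one. The bound `m / 2 + 1` ensures that the part of `odds x` used in a
query is really known and not zero padding. -/
theorem univSearch_val {x y : Baire} {n j m : ℕ}
    (hj : evens x (query (initSeg (odds x) j) n) = y n + 1)
    (hlt : ∀ i < j, evens x (query (initSeg (odds x) i) n) = 0) :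
    ∀ K ≤ m / 2 + 1, (univSearch (initSeg x m) n K = 0 ∧ K ≤ j) ∨
      (univSearch (initSeg x m) n K = 1 ∧ ∃ i ≤ j, m ≤ 2 * query (initSeg (odds x) i) n) ∨
      univSearch (initSeg x m) n K = y n + 2 := by
  intro K
  induction K with
  | zero => exact fun _ => Or.inl ⟨rfl, Nat.zero_le _⟩
  | succ K ih =>
    intro hK
    have e := univSearch_succ x n (show K ≤ m / 2 by omega)
    rcases ih (by omega) with ⟨h, hKj⟩ | ⟨h, hi⟩ | h
    · rcases Nat.lt_or_ge (2 * query (initSeg (odds x) K) n) m with hm | hm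
      · rw [h, getElem?_initSeg x hm] at e
        rcases hKj.lt_or_eq with hl | rfl
        · left
          have h0 : x (2 * query (initSeg (odds x) K) n) = 0 := hlt K hl
          rw [h0] at e
          exact ⟨e, hl⟩
        · right; right
          have h0 : x (2 * query (initSeg (odds x) K) n) = y n + 1 := hj
          rw [h0] at e
          exact e
      · right; left
        rw [h, getElem?_initSeg_of_le x hm] at e
        exact ⟨e, K, hKj, hm⟩
    · right; left
      rw [h] at e
      exact ⟨e, hi⟩
    · right; right
      rw [h] at e
      exact e

theorem exists_gt_of_le (u : ℕ → ℕ) (j : ℕ) : ∃ m, ∀ i ≤ j, u i < m := by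
  refine ⟨(Finset.range (j + 1)).sup u + 1, fun i hi => Nat.lt_succ_of_le ?_⟩
  exact Finset.le_sup (f := u) (Finset.mem_range.2 (by omega))

theorem compOn_ev : CompOn {x | (Phi (evens x) (odds x)).Dom}
    fun x => ev (evens x) (odds x) := by
  -- Subtracting one sends both failures, `0` and `1`, to `0`, and success `y n + 2` to the required
  -- `y n + 1`.
  refine compOn_of_approx (fun τ n => univSearch τ n (τ.length / 2 + 1) - 1)
    (Primrec.pred.comp primrec_univSearch).to_comp fun x hx n => ?_
  obtain ⟨j, hj, hlt⟩ := (mem_Phi_iff _ _ _).1 (ev_mem hx) n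
  simp only [length_initSeg]
  refine ⟨fun m => ?_, ?_⟩
  · rcases univSearch_val (m := m) hj hlt _ le_rfl with ⟨h, -⟩ | ⟨h, -⟩ | h <;> rw [h] <;> simp
  · obtain ⟨M, hM⟩ := exists_gt_of_le (fun i => 2 * query (initSeg (odds x) i) n) j
    -- The summand `M` makes every entry queried up to stage `j` known; `2 * j` makes the search
    -- bound exceed `j`.
    refine ⟨M + 2 * j, ?_⟩
    rcases univSearch_val (m := M + 2 * j) hj hlt _ le_rfl with ⟨-, h⟩ | ⟨-, i, hi, h⟩ | h
    · omega
    · have := hM i hi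
      omega
    · rw [h]
      omega

theorem CompOn.ev {D : Set Baire} {φ ψ : Baire → Baire} (hφ : CompOn D φ)
    (hψ : CompOn D ψ) (h : ∀ p ∈ D, (Phi (φ p) (ψ p)).Dom) :
    CompOn D fun p => ev (φ p) (ψ p) := by
  refine (compOn_ev.comp (hφ.pr hψ) fun p hp => ?_).congr fun p _ => by
    simp only [evens_pr, odds_pr]
  simpa only [Set.mem_ofPred_eq, evens_pr, odds_pr] using h p hp

/-- The program that is obtained from `c` by fixing the first component of the input. -/
def smn (c p : Baire) : Baire := fun m =>
  srch c (initSeg (pr p (pad (Denumerable.ofNat (List ℕ) m.unpair.1)))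
    (2 * (Denumerable.ofNat (List ℕ) m.unpair.1).length)) m.unpair.2
    (2 * (Denumerable.ofNat (List ℕ) m.unpair.1).length)

/-- The first `2 * k` symbols of a pair involve only `k` symbols of each component, so the padding
of the second component is invisible. -/
theorem smn_query (c p q : Baire) (k n : ℕ) : smn c p (query (initSeg q k) n) =
    srch c (initSeg (pr p q) (2 * k)) n (2 * k) := by
  have e : initSeg (pr p (pad (initSeg q k))) (2 * k) = initSeg (pr p q) (2 * k) := by
    refine initSeg_congr fun i hi => ?_
    simp only [pr]
    rw [pad_initSeg q (by omega)]
  simp [smn, query, length_initSeg, e]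

theorem mem_Phi_smn {c p q y : Baire} (h : y ∈ Phi c (pr p q)) : y ∈ Phi (smn c p) q := by
  refine mem_Phi_of_approx fun n => ⟨fun m => ?_, ?_⟩
  · rw [smn_query]
    exact srch_val h n _
  · obtain ⟨k, hk⟩ := srch_ne h n
    refine ⟨k, ?_⟩
    rw [smn_query]
    exact hk _ (by omega)

/-- Each entry of the new program depends on a finite, computable part of `p`; this is what makes
`smn c` computable. -/
theorem smn_congr (c : Baire) {p p' : Baire} {m : ℕ}
    (h : ∀ i < (Denumerable.ofNat (List ℕ) m.unpair.1).length, p i = p' i) :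
    smn c p m = smn c p' m := by
  have e : ∀ σ : List ℕ, (∀ i < σ.length, p i = p' i) →
      initSeg (pr p (pad σ)) (2 * σ.length) = initSeg (pr p' (pad σ)) (2 * σ.length) := by
    refine fun σ h => initSeg_congr fun i hi => ?_
    simp only [pr]
    rw [h _ (by omega)]
  rw [smn, smn, e _ h]

theorem computable_smn_pad {c : Baire} (hc : Computable c) :
    Computable fun z : List ℕ × ℕ => smn c (pad z.1) z.2 := by
  have hσ : Primrec fun z : List ℕ × ℕ => Denumerable.ofNat (List ℕ) z.2.unpair.1 :=
    (Primrec.ofNat _).comp (Primrec.fst.comp (Primrec.unpair.comp Primrec.snd))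
  have hl := Primrec.nat_mul.comp (Primrec.const 2) (Primrec.list_length.comp hσ)
  refine computable_srch hc (primrec_initSeg ?_ hl).to_comp
    (Computable.snd.comp (Computable.unpair.comp Computable.snd)) hl.to_comp
  have hi := Primrec.nat_div.comp (Primrec.snd (α := List ℕ × ℕ)) (Primrec.const 2)
  exact Primrec.ite (Primrec.eq.comp (Primrec.nat_mod.comp Primrec.snd (Primrec.const 2))
    (Primrec.const 0)) (primrec_pad (Primrec.fst.comp Primrec.fst) hi)
    (primrec_pad (hσ.comp Primrec.fst) hi)

theorem compOn_smn {c : Baire} (hc : Computable c) : CompOn Set.univ (smn c) := by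
  refine compOn_of_approx (fun τ m =>
    bif (Denumerable.ofNat (List ℕ) m.unpair.1).length ≤ τ.length then
      smn c (pad τ) m + 1 else 0) ?_ fun p _ n => ?_
  · have hσ : Computable fun z : List ℕ × ℕ =>
        (Denumerable.ofNat (List ℕ) z.2.unpair.1).length :=
      Computable.list_length.comp ((Computable.ofNat _).comp
        (Computable.fst.comp (Computable.unpair.comp Computable.snd)))
    exact Computable.cond ((Primrec.nat_le.decide.to_comp).comp hσ
      (Computable.list_length.comp Computable.fst))
      (Computable.succ.comp (computable_smn_pad hc)) (Computable.const 0)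
  · have hv : ∀ m, (Denumerable.ofNat (List ℕ) n.unpair.1).length ≤ m →
        smn c (pad (initSeg p m)) n = smn c p n := fun m hm =>
      smn_congr c fun i hi => pad_initSeg p (by omega)
    simp only [length_initSeg]
    refine ⟨fun m => ?_, (Denumerable.ofNat (List ℕ) n.unpair.1).length, by simp⟩
    by_cases hm : (Denumerable.ofNat (List ℕ) n.unpair.1).length ≤ m
    · right
      simp [hm, hv m hm]
    · left
      simp [hm]

/-- A computable function of pairs has programs, for the second argument, that can be computed
from the first one. -/
theorem CompOn.exists_smn {E : Set Baire} {ψ : Baire → Baire} (h : CompOn E ψ) :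
    ∃ S : Baire → Baire, CompOn Set.univ S ∧
      ∀ p q, Weihrauch.pr p q ∈ E → ψ (Weihrauch.pr p q) ∈ Phi (S p) q := by
  obtain ⟨c, hc, h⟩ := h
  exact ⟨smn c, compOn_smn hc, fun p q hpq => mem_Phi_smn (h _ hpq)⟩

/-! ### Reducibility of multi-valued functions on Baire space -/

theorem pr_evens_odds (p : Baire) : pr (evens p) (odds p) = p := by
  funext n
  rcases Nat.mod_two_eq_zero_or_one n with h | h
  · simp only [pr, h, if_true, evens]
    congr 1
    omega
  · simp only [pr, h, one_ne_zero, if_false, odds]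
    congr 1
    omega

/-- The pairs of an instance `p` of `f` and a solution of the instance `H p` of `g`. -/
def runs (f g : MV Baire Baire) (H : Baire → Baire) : Set Baire :=
  {c | evens c ∈ f.dom ∧ odds c ∈ g (H (evens c))}

/-- Weihrauch reducibility of multi-valued functions on Baire space. -/
def Red (f g : MV Baire Baire) : Prop :=
  ∃ H K : Baire → Baire, CompOn f.dom H ∧ (∀ p ∈ f.dom, H p ∈ g.dom) ∧
    CompOn (runs f g H) K ∧ ∀ c ∈ runs f g H, K c ∈ f (evens c)

/-- What remains to be done for `f` once the instance `H p` of `g` is solved. -/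
def residual (f g : MV Baire Baire) (H : Baire → Baire) : MV Baire Baire :=
  fun c => {s | s ∈ f (evens c) ∧ odds c ∈ g (H (evens c))}

theorem dom_residual (f g : MV Baire Baire) (H : Baire → Baire) :
    (residual f g H).dom = runs f g H := by
  ext c
  exact ⟨fun ⟨s, hs, hc⟩ => ⟨⟨s, hs⟩, hc⟩, fun ⟨⟨s, hs⟩, hc⟩ => ⟨s, hs, hc⟩⟩

theorem Red.of_map {f g : MV Baire Baire} (φ : Baire → Baire) (hφ : CompOn f.dom φ)
    (hd : ∀ p ∈ f.dom, φ p ∈ g.dom) (hs : ∀ p ∈ f.dom, g (φ p) ⊆ f p) : Red f g :=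
  ⟨φ, odds, hφ, hd, CompOn.id.odds, fun _ hc => hs _ hc.1 hc.2⟩

theorem Red.refl (f : MV Baire Baire) : Red f f :=
  .of_map (fun p => p) .id (fun _ h => h) fun _ _ => subset_rfl

theorem Red.trans {f g h : MV Baire Baire} (hfg : Red f g) (hgh : Red g h) : Red f h := by
  obtain ⟨H, K, hH, hd, hK, hs⟩ := hfg
  obtain ⟨H', K', hH', hd', hK', hs'⟩ := hgh
  have h1 : ∀ c ∈ runs f h (fun p => H' (H p)), pr (H (evens c)) (odds c) ∈ runs g h H' :=
    fun c hc => by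
      simp only [runs, Set.mem_ofPred_eq, evens_pr, odds_pr]
      exact ⟨hd _ hc.1, hc.2⟩
  have h2 : ∀ c ∈ runs f h (fun p => H' (H p)),
      pr (evens c) (K' (pr (H (evens c)) (odds c))) ∈ runs f g H := fun c hc => by
    simp only [runs, Set.mem_ofPred_eq, evens_pr, odds_pr]
    refine ⟨hc.1, ?_⟩
    simpa only [evens_pr] using hs' _ (h1 c hc)
  refine ⟨fun p => H' (H p), fun c => K (pr (evens c) (K' (pr (H (evens c)) (odds c)))),
    hH'.comp hH hd, fun p hp => hd' _ (hd p hp), hK.comp (CompOn.id.evens.pr (hK'.comp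
      ((hH.comp CompOn.id.evens fun c hc => hc.1).pr CompOn.id.odds) h1)) h2, fun c hc => ?_⟩
  simpa only [evens_pr] using hs _ (h2 c hc)

/-! ### The compositional product and its residual characterization -/

/-- The compositional product on Baire space. -/
def starN (f g : MV Baire Baire) : MV Baire Baire := fun p =>
  {w | (∀ q ∈ g (odds p), ∀ r, ∃ t ∈ Phi (evens p) (pr q r), odds t ∈ f.dom) ∧
    ∃ q ∈ g (odds p), ∃ r, ∃ t ∈ Phi (evens p) (pr q r),
      evens w = evens t ∧ odds w ∈ f (odds t)}

theorem mem_dom_starN {f g : MV Baire Baire} {p : Baire} : p ∈ (starN f g).dom ↔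
    odds p ∈ g.dom ∧
      ∀ q ∈ g (odds p), ∀ r, ∃ t ∈ Phi (evens p) (pr q r), odds t ∈ f.dom := by
  constructor
  · rintro ⟨w, h, q, hq, -⟩
    exact ⟨⟨q, hq⟩, h⟩
  · rintro ⟨⟨q, hq⟩, h⟩
    -- The second component of the input is the padding of the cylindrified representation; any
    -- value serves.
    obtain ⟨t, ht, v, hv⟩ := h q hq fun _ => 0
    refine ⟨pr (evens t) v, h, q, hq, fun _ => 0, t, ht, ?_⟩
    rw [evens_pr, odds_pr]
    exact ⟨rfl, hv⟩

theorem mem_runs {k g : MV Baire Baire} {H : Baire → Baire} {p q : Baire} :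
    pr p q ∈ runs k g H ↔ p ∈ k.dom ∧ q ∈ g (H p) := by
  simp only [runs, Set.mem_ofPred_eq, evens_pr, odds_pr]

/-- Once the first part `g` of an instance of `f ⋆ g` is solved, an instance of `f` can be
computed. -/
theorem exists_second_instance {k f g : MV Baire Baire} {H : Baire → Baire}
    (hH : CompOn k.dom H) (hd : ∀ p ∈ k.dom, H p ∈ (starN f g).dom) :
    ∃ T : Baire → Baire, CompOn (runs k g fun p => odds (H p)) T ∧
      ∀ c ∈ runs k g fun p => odds (H p), odds (T c) ∈ f.dom ∧
        ∀ w ∈ f (odds (T c)), pr (evens (T c)) w ∈ starN f g (H (evens c)) := by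
  have hT : ∀ c ∈ runs k g fun p => odds (H p),
      ∃ t ∈ Phi (evens (H (evens c))) (pr (odds c) fun _ => 0), odds t ∈ f.dom :=
    fun c hc => (mem_dom_starN.1 (hd _ hc.1)).2 _ hc.2 _
  refine ⟨fun c => ev (evens (H (evens c))) (pr (odds c) fun _ => 0), ?_, fun c hc => ?_⟩
  · have h1 : CompOn (runs k g fun p => odds (H p)) fun c => H (evens c) :=
      hH.comp CompOn.id.evens fun c hc => hc.1
    refine h1.evens.ev (CompOn.id.odds.pr .zero) fun c hc => ?_
    obtain ⟨t, ht, -⟩ := hT c hc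
    exact Part.dom_iff_mem.2 ⟨t, ht⟩
  · obtain ⟨t, ht, hf⟩ := hT c hc
    simp only [ev_eq ht]
    refine ⟨hf, fun w hw => ⟨(mem_dom_starN.1 (hd _ hc.1)).2, _, hc.2, _, t, ht, ?_⟩⟩
    rw [evens_pr, odds_pr]
    exact ⟨rfl, hw⟩

/-- Instances of `f ⋆ g` can be computed from instances `H p` of `g` and functions `M` that,
given a solution, compute an instance of `f`. -/
theorem exists_star_instance {k f g : MV Baire Baire} {H M : Baire → Baire}
    (hH : CompOn k.dom H) (hd : ∀ p ∈ k.dom, H p ∈ g.dom)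
    (hM : CompOn (runs k g H) M) (hMd : ∀ c ∈ runs k g H, odds (M c) ∈ f.dom) :
    ∃ H' : Baire → Baire, CompOn k.dom H' ∧ ∀ p ∈ k.dom, H' p ∈ (starN f g).dom ∧
      ∀ w ∈ starN f g (H' p), ∃ q ∈ g (H p), evens w = evens (M (pr p q)) ∧
        odds w ∈ f (odds (M (pr p q))) := by
  -- The program is made for the function of `p` and `pr q r` that ignores the padding `r`, so all
  -- its runs on one solution `q` give the same output.
  obtain ⟨S, hS, hSp⟩ := CompOn.exists_smn (hM.comp
    (D := {x | pr (evens x) (evens (odds x)) ∈ runs k g H})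
    (CompOn.id.evens.pr CompOn.id.odds.evens) fun _ h => h)
  simp only [Set.mem_ofPred_eq, evens_pr, odds_pr] at hSp
  have hp : ∀ p ∈ k.dom, ∀ q ∈ g (H p), ∀ r, M (pr p q) ∈ Phi (S p) (pr q r) :=
    fun p hp q hq r => by
      simpa only [evens_pr] using hSp p (pr q r) (by rw [evens_pr]; exact mem_runs.2 ⟨hp, hq⟩)
  refine ⟨fun p => pr (S p) (H p), (hS.mono fun _ _ => trivial).pr hH, fun p hpk => ⟨?_, ?_⟩⟩
  · rw [mem_dom_starN, odds_pr, evens_pr]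
    exact ⟨hd p hpk, fun q hq r => ⟨_, hp p hpk q hq r, hMd _ (mem_runs.2 ⟨hpk, hq⟩)⟩⟩
  · rintro w ⟨-, q, hq, r, t, ht, h⟩
    rw [evens_pr] at ht
    rw [odds_pr] at hq
    rw [Part.mem_unique ht (hp p hpk q hq r)] at h
    exact ⟨q, hq, h⟩

/-- An instance of `f ⋆ g` consists of an instance of `g` and a program that turns its solutions
into instances of `f`. Running the program is the forward part of a reduction of the residual
problem; conversely, the smn-property packs such a forward part into a program. -/
theorem red_star_iff {k f g : MV Baire Baire} : Red k (starN f g) ↔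
    ∃ H : Baire → Baire, CompOn k.dom H ∧ (∀ p ∈ k.dom, H p ∈ g.dom) ∧
      Red (residual k g H) f := by
  constructor
  · rintro ⟨H, K, hH, hd, hK, hs⟩
    obtain ⟨T, hT, hTd⟩ := exists_second_instance hH hd
    have hr : ∀ c ∈ runs (residual k g fun p => odds (H p)) f fun c => odds (T c),
        evens c ∈ (runs k g fun p => odds (H p)) ∧
        pr (evens (evens c)) (pr (evens (T (evens c))) (odds c)) ∈ runs k (starN f g) H := by
      rintro c ⟨hc, hw⟩
      rw [dom_residual] at hc
      exact ⟨hc, mem_runs.2 ⟨hc.1, (hTd _ hc).2 _ hw⟩⟩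
    refine ⟨fun p => odds (H p), hH.odds, fun p hp => (mem_dom_starN.1 (hd p hp)).1,
      fun c => odds (T c), fun c => K (pr (evens (evens c)) (pr (evens (T (evens c))) (odds c))),
      ?_, ?_, ?_, fun c hc => ⟨?_, (hr c hc).1.2⟩⟩
    · rw [dom_residual]
      exact hT.odds
    · rw [dom_residual]
      exact fun c hc => (hTd c hc).1
    · exact hK.comp (CompOn.id.evens.evens.pr (CompOn.pr
        (hT.comp CompOn.id.evens fun c hc => (hr c hc).1).evens CompOn.id.odds))
        fun c hc => (hr c hc).2
    · simpa only [evens_pr] using hs _ (hr c hc).2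
  · rintro ⟨H, hH, hd, H1, K1, hH1, hd1, hK1, hs1⟩
    rw [dom_residual] at hH1 hd1
    -- The component that `⋆` hands through unchanged stores `c`, the instance together with the
    -- solution of `g`. Hence a solution of `f ⋆ g` already contains all that `K1` needs.
    obtain ⟨H', hH', hd'⟩ := exists_star_instance (f := f) hH hd (CompOn.id.pr hH1)
      fun c hc => by rw [odds_pr]; exact hd1 c hc
    simp only [evens_pr, odds_pr] at hd'
    have hr : ∀ c ∈ runs k (starN f g) H',
        odds c ∈ runs (residual k g H) f H1 ∧ evens (evens (odds c)) = evens c := by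
      rintro c ⟨hc, hw⟩
      obtain ⟨q, hq, h1, h2⟩ := (hd' _ hc).2 _ hw
      refine ⟨⟨?_, by rw [h1]; exact h2⟩, by rw [h1, evens_pr]⟩
      rw [dom_residual, h1]
      exact mem_runs.2 ⟨hc, hq⟩
    refine ⟨H', fun c => K1 (odds c), hH', fun p hp => (hd' p hp).1,
      hK1.comp CompOn.id.odds fun c hc => (hr c hc).1, fun c hc => ?_⟩
    rw [← (hr c hc).2]
    exact (hs1 _ (hr c hc).1).1

/-- Replacing the instance of `g` by one of `g'` changes the residual problem only by a translation
of solutions with `Kg`, and the old residual lies below `f`, hence below `f'`. -/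
theorem Red.star_mono {f f' g g' : MV Baire Baire} (hf : Red f f') (hg : Red g g') :
    Red (starN f g) (starN f' g') := by
  obtain ⟨H, hH, hd, hR⟩ := red_star_iff.1 (Red.refl (starN f g))
  obtain ⟨Hg, Kg, hHg, hdg, hKg, hsg⟩ := hg
  refine red_star_iff.2 ⟨fun p => Hg (H p), hHg.comp hH hd, fun p hp => hdg _ (hd p hp),
    (Red.of_map (fun c => pr (evens c) (Kg (pr (H (evens c)) (odds c)))) ?_ ?_ ?_).trans
      (hR.trans hf)⟩
  all_goals
    rw [dom_residual]
    have h1 : ∀ c ∈ runs (starN f g) g' fun p => Hg (H p),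
        pr (H (evens c)) (odds c) ∈ runs g g' Hg := fun c hc => by
      simp only [runs, Set.mem_ofPred_eq, evens_pr, odds_pr]
      exact ⟨hd _ hc.1, hc.2⟩
  · exact CompOn.id.evens.pr (hKg.comp ((hH.comp CompOn.id.evens fun c hc => hc.1).pr
      CompOn.id.odds) h1)
  · intro c hc
    rw [dom_residual]
    simp only [runs, Set.mem_ofPred_eq, evens_pr, odds_pr]
    refine ⟨hc.1, ?_⟩
    simpa only [evens_pr] using hsg _ (h1 c hc)
  · rintro c hc s ⟨h, -⟩
    rw [evens_pr] at h
    exact ⟨h, hc.2⟩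

/-- Taking residuals twice means solving `h`, then `g`, then what is left with `f`. The first two
stages are bundled into one instance of `g ⋆ h` that keeps the solution of `h`; the residuals then
differ by rebracketing the data. -/
theorem Red.star_assoc {k f g h : MV Baire Baire} (hk : Red k (starN (starN f g) h)) :
    Red k (starN f (starN g h)) := by
  obtain ⟨H, hH, hd, hR⟩ := red_star_iff.1 hk
  obtain ⟨H', hH', hd', hR'⟩ := red_star_iff.1 hR
  rw [dom_residual] at hH' hd'
  obtain ⟨H'', hH'', hd''⟩ := exists_star_instance (f := g) hH hd (CompOn.id.odds.pr hH')
    fun c hc => by rw [odds_pr]; exact hd' c hc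
  simp only [evens_pr, odds_pr] at hd''
  refine red_star_iff.2 ⟨H'', hH'', fun p hp => (hd'' p hp).1,
    (Red.of_map (fun c => pr (pr (evens c) (evens (odds c))) (odds (odds c)))
      ((CompOn.id.evens.pr CompOn.id.odds.evens).pr CompOn.id.odds.odds) ?_ ?_).trans hR'⟩
  · rw [dom_residual]
    rintro c ⟨hc, hw⟩
    obtain ⟨q, hq, h1, h2⟩ := (hd'' _ hc).2 _ hw
    rw [dom_residual, h1, mem_runs, dom_residual, mem_runs]
    exact ⟨⟨hc, hq⟩, h2⟩
  · rw [dom_residual]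
    rintro c ⟨-, hc⟩ s ⟨⟨hs, -⟩, -⟩
    rw [evens_pr, evens_pr] at hs
    exact ⟨hs, hc⟩

/-- The instance of `g ⋆ h` is split: its `h`-part is solved first, `T` supplies the instance of
`g`, and the two results are reassembled into a solution of `g ⋆ h` for the final residual. -/
theorem Red.star_assoc_symm {k f g h : MV Baire Baire} (hk : Red k (starN f (starN g h))) :
    Red k (starN (starN f g) h) := by
  obtain ⟨H, hH, hd, hR⟩ := red_star_iff.1 hk
  obtain ⟨T, hT, hTd⟩ := exists_second_instance hH hd
  refine red_star_iff.2 ⟨fun p => odds (H p), hH.odds,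
    fun p hp => (mem_dom_starN.1 (hd p hp)).1, red_star_iff.2
    ⟨fun c => odds (T c), ?_, ?_, (Red.of_map (fun c => pr (evens (evens c))
      (pr (evens (T (evens c))) (odds c))) ?_ ?_ ?_).trans hR⟩⟩
  · rw [dom_residual]
    exact hT.odds
  · rw [dom_residual]
    exact fun c hc => (hTd c hc).1
  all_goals
    rw [dom_residual]
    have hr : ∀ c ∈ runs (residual k h fun p => odds (H p)) g fun c => odds (T c),
        evens c ∈ (runs k h fun p => odds (H p)) := fun c hc => by
      rw [← dom_residual]
      exact hc.1
  · exact CompOn.id.evens.evens.pr ((hT.comp CompOn.id.evens hr).evens.pr CompOn.id.odds)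
  · intro c hc
    rw [dom_residual, mem_runs]
    exact ⟨(hr c hc).1, (hTd _ (hr c hc)).2 _ hc.2⟩
  · rintro c hc s ⟨hs, -⟩
    rw [evens_pr] at hs
    exact ⟨⟨hs, (hr c hc).2⟩, hc.2⟩

/-! ### Products, meets and joins on Baire space -/

/-- The one-point problem on Baire space. -/
def oneN : MV Baire Baire := fun _ => Set.univ

/-- Products on Baire space. -/
def prodN (f g : MV Baire Baire) : MV Baire Baire := fun p =>
  {w | evens w ∈ f (evens p) ∧ odds w ∈ g (odds p)}

/-- Meets on Baire space. -/
def meetN (f g : MV Baire Baire) : MV Baire Baire := fun p =>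
  {w | evens p ∈ f.dom ∧ odds p ∈ g.dom ∧
    (w 0 = 0 ∧ tail w ∈ f (evens p) ∨ w 0 = 1 ∧ tail w ∈ g (odds p))}

/-- Joins on Baire space. -/
def joinN (f g : MV Baire Baire) : MV Baire Baire := fun p =>
  {w | p 0 = 0 ∧ w 0 = 0 ∧ tail w ∈ f (tail p) ∨ p 0 = 1 ∧ w 0 = 1 ∧ tail w ∈ g (tail p)}

theorem mem_dom_prodN {f g : MV Baire Baire} {p : Baire} :
    p ∈ (prodN f g).dom ↔ evens p ∈ f.dom ∧ odds p ∈ g.dom := by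
  constructor
  · rintro ⟨w, h1, h2⟩
    exact ⟨⟨_, h1⟩, ⟨_, h2⟩⟩
  · rintro ⟨⟨v, hv⟩, ⟨w, hw⟩⟩
    refine ⟨pr v w, ?_⟩
    simp only [prodN, Set.mem_ofPred_eq, evens_pr, odds_pr]
    exact ⟨hv, hw⟩

theorem mem_dom_meetN {f g : MV Baire Baire} {p : Baire} :
    p ∈ (meetN f g).dom ↔ evens p ∈ f.dom ∧ odds p ∈ g.dom := by
  constructor
  · rintro ⟨w, h1, h2, -⟩
    exact ⟨h1, h2⟩
  · rintro ⟨⟨v, hv⟩, h⟩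
    exact ⟨cons 0 v, ⟨v, hv⟩, h, Or.inl ⟨rfl, hv⟩⟩

theorem mem_dom_joinN {f g : MV Baire Baire} {p : Baire} : p ∈ (joinN f g).dom ↔
    p 0 = 0 ∧ tail p ∈ f.dom ∨ p 0 = 1 ∧ tail p ∈ g.dom := by
  constructor
  · rintro ⟨w, ⟨h1, -, h2⟩ | ⟨h1, -, h2⟩⟩
    · exact Or.inl ⟨h1, _, h2⟩
    · exact Or.inr ⟨h1, _, h2⟩
  · rintro (⟨h, v, hv⟩ | ⟨h, v, hv⟩)
    · exact ⟨cons 0 v, Or.inl ⟨h, rfl, hv⟩⟩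
    · exact ⟨cons 1 v, Or.inr ⟨h, rfl, hv⟩⟩

theorem red_star_one (f : MV Baire Baire) : Red f (starN f oneN) := by
  refine red_star_iff.2 ⟨fun p => p, .id, fun p _ => ⟨p, trivial⟩,
    .of_map evens CompOn.id.evens ?_ ?_⟩
  all_goals rw [dom_residual]
  · exact fun c hc => hc.1
  · exact fun c hc s hs => ⟨hs, hc.2⟩

theorem Red.prod_mono {f f' g g' : MV Baire Baire} (hf : Red f f') (hg : Red g g') :
    Red (prodN f g) (prodN f' g') := by
  obtain ⟨H, K, hH, hd, hK, hs⟩ := hf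
  obtain ⟨H', K', hH', hd', hK', hs'⟩ := hg
  have h1 : ∀ c ∈ runs (prodN f g) (prodN f' g') fun p => Weihrauch.pr (H (evens p)) (H' (odds p)),
      Weihrauch.pr (evens (evens c)) (evens (odds c)) ∈ runs f f' H ∧
      Weihrauch.pr (odds (evens c)) (odds (odds c)) ∈ runs g g' H' := by
    rintro c ⟨hc, h1, h2⟩
    rw [mem_dom_prodN] at hc
    rw [evens_pr] at h1
    rw [odds_pr] at h2
    exact ⟨mem_runs.2 ⟨hc.1, h1⟩, mem_runs.2 ⟨hc.2, h2⟩⟩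
  refine ⟨fun p => pr (H (evens p)) (H' (odds p)),
    fun c => pr (K (pr (evens (evens c)) (evens (odds c))))
      (K' (pr (odds (evens c)) (odds (odds c)))), ?_, fun p hp => ?_, ?_, fun c hc => ⟨?_, ?_⟩⟩
  · exact (hH.comp CompOn.id.evens fun p hp => (mem_dom_prodN.1 hp).1).pr
      (hH'.comp CompOn.id.odds fun p hp => (mem_dom_prodN.1 hp).2)
  · rw [mem_dom_prodN] at hp ⊢
    rw [evens_pr, odds_pr]
    exact ⟨hd _ hp.1, hd' _ hp.2⟩
  · exact (hK.comp (CompOn.id.evens.evens.pr CompOn.id.odds.evens) fun c hc => (h1 c hc).1).pr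
      (hK'.comp (CompOn.id.evens.odds.pr CompOn.id.odds.odds) fun c hc => (h1 c hc).2)
  · rw [evens_pr]
    simpa only [evens_pr] using hs _ (h1 c hc).1
  · rw [odds_pr]
    simpa only [evens_pr] using hs' _ (h1 c hc).2

theorem red_prod_star (f g : MV Baire Baire) : Red (prodN f g) (starN f g) := by
  refine red_star_iff.2 ⟨odds, CompOn.id.odds, fun p hp => (mem_dom_prodN.1 hp).2,
    fun c => evens (evens c), fun c => pr (odds c) (odds (evens c)), ?_, ?_, ?_, ?_⟩
  · exact CompOn.id.evens.evens
  · rw [dom_residual]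
    exact fun c hc => (mem_dom_prodN.1 hc.1).1
  · exact CompOn.id.odds.pr CompOn.id.evens.odds
  · rintro c ⟨hc, hw⟩
    rw [dom_residual] at hc
    refine ⟨?_, hc.2⟩
    simp only [prodN, Set.mem_ofPred_eq, evens_pr, odds_pr]
    exact ⟨hw, hc.2⟩

/-- The inner problems are solved in parallel; the residual of the product then maps to the product
of the residuals. -/
theorem Red.prod_star {k l f f' g g' : MV Baire Baire} (hk : Red k (starN f g))
    (hl : Red l (starN f' g')) : Red (prodN k l) (starN (prodN f f') (prodN g g')) := by
  obtain ⟨H, hH, hd, hR⟩ := red_star_iff.1 hk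
  obtain ⟨H', hH', hd', hR'⟩ := red_star_iff.1 hl
  refine red_star_iff.2 ⟨fun p => pr (H (evens p)) (H' (odds p)), ?_, fun p hp => ?_,
    (Red.of_map (fun c => pr (pr (evens (evens c)) (evens (odds c)))
      (pr (odds (evens c)) (odds (odds c)))) ?_ ?_ ?_).trans (hR.prod_mono hR')⟩
  · exact (hH.comp CompOn.id.evens fun p hp => (mem_dom_prodN.1 hp).1).pr
      (hH'.comp CompOn.id.odds fun p hp => (mem_dom_prodN.1 hp).2)
  · rw [mem_dom_prodN] at hp ⊢
    rw [evens_pr, odds_pr]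
    exact ⟨hd _ hp.1, hd' _ hp.2⟩
  · exact (CompOn.id.evens.evens.pr CompOn.id.odds.evens).pr
      (CompOn.id.evens.odds.pr CompOn.id.odds.odds)
  all_goals rw [dom_residual]
  · rintro c ⟨hc, h1, h2⟩
    rw [mem_dom_prodN] at hc
    rw [evens_pr] at h1
    rw [odds_pr] at h2
    rw [mem_dom_prodN, evens_pr, odds_pr, dom_residual, dom_residual, mem_runs, mem_runs]
    exact ⟨⟨hc.1, h1⟩, ⟨hc.2, h2⟩⟩
  · rintro c ⟨-, hc⟩ s ⟨⟨h1, -⟩, ⟨h2, -⟩⟩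
    rw [evens_pr, evens_pr] at h1
    rw [odds_pr, evens_pr] at h2
    exact ⟨⟨h1, h2⟩, hc⟩

theorem red_meet_left (f g : MV Baire Baire) : Red (meetN f g) f :=
  ⟨evens, fun c => cons 0 (odds c), CompOn.id.evens, fun _ hp => (mem_dom_meetN.1 hp).1,
    CompOn.id.odds.cons 0, fun _ hc => ⟨(mem_dom_meetN.1 hc.1).1, (mem_dom_meetN.1 hc.1).2,
      Or.inl ⟨rfl, hc.2⟩⟩⟩

theorem red_meet_right (f g : MV Baire Baire) : Red (meetN f g) g :=
  ⟨odds, fun c => cons 1 (odds c), CompOn.id.odds, fun _ hp => (mem_dom_meetN.1 hp).2,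
    CompOn.id.odds.cons 1, fun _ hc => ⟨(mem_dom_meetN.1 hc.1).1, (mem_dom_meetN.1 hc.1).2,
      Or.inr ⟨rfl, hc.2⟩⟩⟩

/-- Both instances are posed, and the first symbol of the answer tells which backward map applies.
-/
theorem Red.le_meet {k f g : MV Baire Baire} (hf : Red k f) (hg : Red k g) :
    Red k (meetN f g) := by
  obtain ⟨H, K, hH, hd, hK, hs⟩ := hf
  obtain ⟨H', K', hH', hd', hK', hs'⟩ := hg
  have h0 : ∀ c ∈ runs k (meetN f g) fun p => pr (H p) (H' p), odds c 0 = 0 →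
      pr (evens c) (tail (odds c)) ∈ runs k f H := by
    rintro c ⟨hc, -, -, ⟨-, h⟩ | ⟨h, -⟩⟩ h'
    · rw [evens_pr] at h
      exact mem_runs.2 ⟨hc, h⟩
    · omega
  have h1 : ∀ c ∈ runs k (meetN f g) fun p => pr (H p) (H' p), odds c 0 ≠ 0 →
      pr (evens c) (tail (odds c)) ∈ runs k g H' := by
    rintro c ⟨hc, -, -, ⟨h, -⟩ | ⟨-, h⟩⟩ h'
    · omega
    · rw [odds_pr] at h
      exact mem_runs.2 ⟨hc, h⟩
  refine ⟨fun p => pr (H p) (H' p), fun c => if odds c 0 = 0 then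
    K (pr (evens c) (tail (odds c))) else K' (pr (evens c) (tail (odds c))), hH.pr hH',
    fun p hp => ?_, ?_, fun c hc => ?_⟩
  · rw [mem_dom_meetN, evens_pr, odds_pr]
    exact ⟨hd p hp, hd' p hp⟩
  · exact CompOn.ite CompOn.id.odds
      (hK.comp (CompOn.id.evens.pr CompOn.id.odds.tail) fun c hc => h0 c hc.1 hc.2)
      (hK'.comp (CompOn.id.evens.pr CompOn.id.odds.tail) fun c hc => h1 c hc.1 hc.2)
  · by_cases h : odds c 0 = 0
    · simpa only [h, if_true, evens_pr] using hs _ (h0 c hc h)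
    · simpa only [h, if_false, evens_pr] using hs' _ (h1 c hc h)

/-- It is not known in advance which of `f` and `f'` gets answered, so `g` and `g'` are both solved.
The residual problem is then below `f` and below `f'`, hence below their meet. -/
theorem Red.meet_star {k f f' g g' : MV Baire Baire} (hk : Red k (starN f g))
    (hl : Red k (starN f' g')) : Red k (starN (meetN f f') (prodN g g')) := by
  obtain ⟨H, hH, hd, hR⟩ := red_star_iff.1 hk
  obtain ⟨H', hH', hd', hR'⟩ := red_star_iff.1 hl
  refine red_star_iff.2 ⟨fun p => pr (H p) (H' p), hH.pr hH', fun p hp => ?_,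
    ((Red.of_map (fun c => pr (evens c) (evens (odds c))) ?_ ?_ ?_).trans hR).le_meet
      ((Red.of_map (fun c => pr (evens c) (odds (odds c))) ?_ ?_ ?_).trans hR')⟩
  · rw [mem_dom_prodN, evens_pr, odds_pr]
    exact ⟨hd p hp, hd' p hp⟩
  · exact CompOn.id.evens.pr CompOn.id.odds.evens
  rotate_left 2
  · exact CompOn.id.evens.pr CompOn.id.odds.odds
  all_goals rw [dom_residual]
  · rintro c ⟨hc, -, h⟩
    rw [odds_pr] at h
    rw [dom_residual, mem_runs]
    exact ⟨hc, h⟩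
  · rintro c ⟨-, hc⟩ s ⟨h, -⟩
    rw [evens_pr] at h
    exact ⟨h, hc⟩
  · rintro c ⟨hc, h, -⟩
    rw [evens_pr] at h
    rw [dom_residual, mem_runs]
    exact ⟨hc, h⟩
  · rintro c ⟨-, hc⟩ s ⟨h, -⟩
    rw [evens_pr] at h
    exact ⟨h, hc⟩

theorem red_left_join (f g : MV Baire Baire) : Red f (joinN f g) := by
  refine ⟨cons 0, fun c => tail (odds c), CompOn.id.cons 0,
    fun p hp => mem_dom_joinN.2 (Or.inl ⟨rfl, hp⟩), CompOn.id.odds.tail, ?_⟩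
  rintro c ⟨-, ⟨-, -, h⟩ | ⟨h, -⟩⟩
  · exact h
  · exact absurd h (by simp [cons])

theorem red_right_join (f g : MV Baire Baire) : Red g (joinN f g) := by
  refine ⟨cons 1, fun c => tail (odds c), CompOn.id.cons 1,
    fun p hp => mem_dom_joinN.2 (Or.inr ⟨rfl, hp⟩), CompOn.id.odds.tail, ?_⟩
  rintro c ⟨-, ⟨h, -⟩ | ⟨-, -, h⟩⟩
  · exact absurd h (by simp [cons])
  · exact h

theorem Red.join_le {k f g : MV Baire Baire} (hf : Red f k) (hg : Red g k) :
    Red (joinN f g) k := by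
  obtain ⟨H, K, hH, hd, hK, hs⟩ := hf
  obtain ⟨H', K', hH', hd', hK', hs'⟩ := hg
  have d0 : ∀ p ∈ (joinN f g).dom, p 0 = 0 → tail p ∈ f.dom := fun p hp h => by
    rcases mem_dom_joinN.1 hp with hp | hp
    · exact hp.2
    · omega
  have d1 : ∀ p ∈ (joinN f g).dom, p 0 ≠ 0 → p 0 = 1 ∧ tail p ∈ g.dom := fun p hp h => by
    rcases mem_dom_joinN.1 hp with hp | hp
    · omega
    · exact hp
  let J : Baire → Baire := fun p => if p 0 = 0 then H (tail p) else H' (tail p)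
  have h0 : ∀ c ∈ runs (joinN f g) k J, evens c 0 = 0 →
      pr (tail (evens c)) (odds c) ∈ runs f k H := by
    rintro c ⟨hc, h⟩ h'
    simp only [J, h', if_true] at h
    exact mem_runs.2 ⟨d0 _ hc h', h⟩
  have h1 : ∀ c ∈ runs (joinN f g) k J, evens c 0 ≠ 0 →
      pr (tail (evens c)) (odds c) ∈ runs g k H' := by
    rintro c ⟨hc, h⟩ h'
    simp only [J, h', if_false] at h
    exact mem_runs.2 ⟨(d1 _ hc h').2, h⟩
  refine ⟨J, fun c => if evens c 0 = 0 then cons 0 (K (pr (tail (evens c)) (odds c)))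
    else cons 1 (K' (pr (tail (evens c)) (odds c))), ?_, fun p hp => ?_, ?_, fun c hc => ?_⟩
  · exact CompOn.ite CompOn.id (hH.comp CompOn.id.tail fun p hp => d0 p hp.1 hp.2)
      (hH'.comp CompOn.id.tail fun p hp => (d1 p hp.1 hp.2).2)
  · by_cases h : p 0 = 0
    · simpa only [J, h, if_true] using hd _ (d0 p hp h)
    · simpa only [J, h, if_false] using hd' _ (d1 p hp h).2
  · exact CompOn.ite CompOn.id.evens
      ((hK.comp (CompOn.id.evens.tail.pr CompOn.id.odds) fun c hc => h0 c hc.1 hc.2).cons 0)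
      ((hK'.comp (CompOn.id.evens.tail.pr CompOn.id.odds) fun c hc => h1 c hc.1 hc.2).cons 1)
  · by_cases h : evens c 0 = 0
    · simp only [h, if_true]
      refine Or.inl ⟨h, rfl, ?_⟩
      simpa only [evens_pr, tail_cons] using hs _ (h0 c hc h)
    · simp only [h, if_false]
      refine Or.inr ⟨(d1 _ hc.1 h).1, rfl, ?_⟩
      simpa only [evens_pr, tail_cons] using hs' _ (h1 c hc h)

/-! ### Implication on Baire space -/

/-- The implication `g → f` on Baire space. -/
def impN (g f : MV Baire Baire) : MV Baire Baire := fun p =>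
  {w | odds w ∈ g.dom ∧ ∀ q ∈ g (odds w), ∀ r, ∃ t ∈ Phi (evens w) (pr q r), t ∈ f p}

theorem dom_impN {g f : MV Baire Baire} (h : g.dom.Nonempty ∨ f.dom = ∅) :
    (impN g f).dom = f.dom := by
  ext p
  constructor
  · rintro ⟨w, ⟨q, hq⟩, hw⟩
    obtain ⟨t, -, ht⟩ := hw q hq fun _ => 0
    exact ⟨t, ht⟩
  · rintro ⟨t, ht⟩
    obtain ⟨x, hx⟩ : g.dom.Nonempty := h.resolve_right fun h' => by
      have : p ∈ f.dom := ⟨t, ht⟩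
      rw [h'] at this
      exact this
    -- `S t` is a program that outputs `t` on every input; with any instance of `g` it solves the
    -- implication.
    obtain ⟨S, -, hS⟩ := CompOn.exists_smn (E := Set.univ) CompOn.id.evens
    refine ⟨pr (S t) x, ?_⟩
    simp only [impN, Set.mem_ofPred_eq, evens_pr, odds_pr]
    refine ⟨hx, fun q _ r => ⟨t, ?_, ht⟩⟩
    simpa only [evens_pr] using hS t (pr q r) trivial

/-- A solution of `g → f` is an instance of `g` with a program turning its solutions into solutions
of `f`. This is a reduction to `g` of the residual problem left by `x`, with the backward map coded
as a program. -/
theorem red_imp_iff {g f x : MV Baire Baire} (h : g.dom.Nonempty ∨ f.dom = ∅) :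
    Red (impN g f) x ↔ Red f (starN g x) := by
  rw [red_star_iff]
  constructor
  · rintro ⟨H, K, hH, hd, hK, hs⟩
    have e : runs (impN g f) x H = runs f x H := by rw [runs, runs, dom_impN h]
    rw [dom_impN h] at hH hd
    rw [e] at hK hs
    have hr : ∀ c ∈ runs (residual f x H) g fun c => odds (K c), evens c ∈ runs f x H ∧
        ∃ t ∈ Phi (evens (K (evens c))) (pr (odds c) fun _ => 0), t ∈ f (evens (evens c)) := by
      rintro c ⟨hc, hw⟩
      rw [dom_residual] at hc
      exact ⟨hc, (hs _ hc).2 _ hw _⟩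
    refine ⟨H, hH, hd, fun c => odds (K c), fun c => ev (evens (K (evens c)))
      (pr (odds c) fun _ => 0), ?_, ?_, ?_, fun c hc => ⟨?_, (hr c hc).1.2⟩⟩
    · rw [dom_residual]
      exact hK.odds
    · rw [dom_residual]
      exact fun c hc => (hs c hc).1
    · refine (hK.comp CompOn.id.evens fun c hc => (hr c hc).1).evens.ev
        (CompOn.id.odds.pr .zero) fun c hc => ?_
      obtain ⟨t, ht, -⟩ := (hr c hc).2
      exact Part.dom_iff_mem.2 ⟨t, ht⟩
    · obtain ⟨t, ht, hf⟩ := (hr c hc).2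
      simp only [ev_eq ht]
      exact hf
  · rintro ⟨H, hH, hd, H1, K1, hH1, hd1, hK1, hs1⟩
    rw [dom_residual] at hH1 hd1
    obtain ⟨S, hS, hSp⟩ := CompOn.exists_smn (hK1.comp
      (D := {y | pr (evens y) (evens (odds y)) ∈ runs (residual f x H) g H1})
      (CompOn.id.evens.pr CompOn.id.odds.evens) fun _ h => h)
    simp only [Set.mem_ofPred_eq, evens_pr, odds_pr] at hSp
    have e : runs (impN g f) x H = runs f x H := by rw [runs, runs, dom_impN h]
    refine ⟨H, fun c => pr (S c) (H1 c), ?_, ?_, ?_, ?_⟩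
    · rwa [dom_impN h]
    · rwa [dom_impN h]
    · rw [e]
      exact (hS.mono fun _ _ => trivial).pr hH1
    · rw [e]
      intro c hc
      simp only [impN, Set.mem_ofPred_eq, evens_pr, odds_pr]
      refine ⟨hd1 c hc, fun q hq r => ?_⟩
      have hm : pr c q ∈ runs (residual f x H) g H1 :=
        mem_runs.2 ⟨by rwa [dom_residual], hq⟩
      refine ⟨K1 (pr c q), ?_, ?_⟩
      · simpa only [evens_pr] using hSp c (pr q r) (by rwa [evens_pr])
      · simpa only [evens_pr] using (hs1 _ hm).1

/-! ### From represented spaces to Baire space -/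

/-- The multi-valued function on names that belongs to a multi-valued function on
represented spaces. -/
def names (f : Problem) : MV Baire Baire := fun p =>
  {q | ∃ x ∈ f.src.rep p, ∃ y ∈ f.tgt.rep q, y ∈ f.fn x}

theorem mem_dom_names {f : Problem} {p : Baire} :
    p ∈ (names f).dom ↔ ∃ x ∈ f.src.rep p, x ∈ f.fn.dom := by
  constructor
  · rintro ⟨q, x, hx, y, -, hy⟩
    exact ⟨x, hx, y, hy⟩
  · rintro ⟨x, hx, y, hy⟩
    obtain ⟨q, hq⟩ := f.tgt.surj y
    exact ⟨q, x, hx, y, hq, hy⟩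

theorem mem_names {f : Problem} {p q : Baire} {x : f.src.carrier} (hx : x ∈ f.src.rep p) :
    q ∈ names f p ↔ ∃ y ∈ f.tgt.rep q, y ∈ f.fn x := by
  constructor
  · rintro ⟨x', hx', h⟩
    rwa [Part.mem_unique hx hx']
  · exact fun h => ⟨x, hx, h⟩

theorem mem_dom_names_of_mem {f : Problem} {p : Baire} {x : f.src.carrier}
    (hx : x ∈ f.src.rep p) : p ∈ (names f).dom ↔ x ∈ f.fn.dom := by
  rw [mem_dom_names]
  constructor
  · rintro ⟨x', hx', h⟩
    rwa [Part.mem_unique hx hx']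
  · exact fun h => ⟨x, hx, h⟩

theorem realizes_iff {F : Baire →. Baire} {f : Problem} :
    Realizes F f ↔ ∀ p ∈ (names f).dom, ∃ q ∈ F p, q ∈ names f p := by
  constructor
  · intro h p hp
    obtain ⟨x, hx, hd⟩ := mem_dom_names.1 hp
    obtain ⟨q, hq, hy⟩ := h p x hx hd
    exact ⟨q, hq, x, hx, hy⟩
  · intro h p x hx hd
    obtain ⟨q, hq, hn⟩ := h p (mem_dom_names.2 ⟨x, hx, hd⟩)
    exact ⟨q, hq, (mem_names hx).1 hn⟩

-- A realizer amounts to a choice of solutions, and choices can be varied one instance at a time. So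
-- a reduction that works for all realizers works for every single solution, with no reference to
-- the rest of the realizer.
open Classical in
theorem wReducible_iff_red {f g : Problem} : WReducible f g ↔ Red (names f) (names g) := by
  constructor
  · rintro ⟨K, H, ⟨d, hd, hK⟩, ⟨c, hc, hH⟩, hr⟩
    -- every choice of solutions of `g` is a realizer
    have key : ∀ γ : Baire → Baire, (∀ q ∈ (names g).dom, γ q ∈ names g q) →
        ∀ p ∈ (names f).dom, ∃ q ∈ H p, q ∈ (names g).dom ∧
          ∃ s ∈ K (pr p (γ q)), s ∈ names f p := by
      intro γ hγ p hp
      -- This realizer is undefined off the domain of `names g`, which forces the query to be a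
      -- genuine instance.
      obtain ⟨s, hs, hn⟩ := realizes_iff.1 (hr (fun q => ⟨q ∈ (names g).dom, fun _ => γ q⟩)
        (realizes_iff.2 fun q hq => ⟨γ q, ⟨hq, rfl⟩, hγ q hq⟩)) p hp
      obtain ⟨q, hq, hs⟩ := Part.mem_bind_iff.1 hs
      obtain ⟨r, ⟨hqd, rfl⟩, hs⟩ := Part.mem_bind_iff.1 hs
      exact ⟨q, hq, hqd, s, hs, hn⟩
    have hex : ∀ q, ∃ r, q ∈ (names g).dom → r ∈ names g q := fun q => by
      by_cases hq : q ∈ (names g).dom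
      · exact hq.imp fun _ h _ => h
      · exact ⟨q, fun h => absurd h hq⟩
    choose γ hγ using hex
    have hev : ∀ p, ∀ q ∈ H p, ev c p = q := fun p q hq => ev_eq (hH p q hq)
    have hev' : ∀ p, ∀ q ∈ K p, ev d p = q := fun p q hq => ev_eq (hK p q hq)
    have hmem : ∀ p ∈ (names f).dom, ev c p ∈ H p ∧ ev c p ∈ (names g).dom := fun p hp => by
      obtain ⟨q, hq, hqd, -⟩ := key γ hγ p hp
      rw [hev p q hq]
      exact ⟨hq, hqd⟩
    have hrun : ∀ a ∈ runs (names f) (names g) (ev c), ev d a ∈ K a ∧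
        ev d a ∈ names f (evens a) := by
      rintro a ⟨hp, ha⟩
      -- The choice is altered at the one query so that it returns the given solution `odds a`.
      obtain ⟨q, hq, -, s, hs, hn⟩ := key (Function.update γ (ev c (evens a)) (odds a))
        (fun q hq => by
          by_cases e : q = ev c (evens a)
          · subst e
            rwa [Function.update_self]
          · rw [Function.update_of_ne e]
            exact hγ q hq) _ hp
      rw [← hev _ _ hq, Function.update_self, pr_evens_odds] at hs
      rw [hev' _ _ hs]
      exact ⟨hs, hn⟩
    exact ⟨ev c, ev d, ⟨c, hc, fun p hp => hH _ _ (hmem p hp).1⟩, fun p hp => (hmem p hp).2,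
      ⟨d, hd, fun a ha => hK _ _ (hrun a ha).1⟩, fun a ha => (hrun a ha).2⟩
  · rintro ⟨H, K, ⟨c, hc, hH⟩, hd, ⟨d, hd', hK⟩, hs⟩
    refine ⟨Phi d, Phi c, ⟨d, hd', fun _ _ h => h⟩, ⟨c, hc, fun _ _ h => h⟩, fun G hG => ?_⟩
    rw [realizes_iff] at hG ⊢
    intro p hp
    obtain ⟨r, hr, hn⟩ := hG _ (hd p hp)
    have hm : pr p r ∈ runs (names f) (names g) H := mem_runs.2 ⟨hp, hn⟩
    refine ⟨K (pr p r), Part.mem_bind (hH p hp) (Part.mem_bind hr (hK _ hm)), ?_⟩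
    simpa only [evens_pr] using hs _ hm

theorem mem_prod_rep {X Y : RepSpace} {p : Baire} {z : X.carrier × Y.carrier} :
    z ∈ (X.prod Y).rep p ↔ z.1 ∈ X.rep (evens p) ∧ z.2 ∈ Y.rep (odds p) := by
  obtain ⟨x, y⟩ := z
  constructor
  · intro h
    obtain ⟨x', hx, h⟩ := Part.mem_bind_iff.1 h
    obtain ⟨y', hy, h⟩ := (Part.mem_map_iff _).1 h
    obtain ⟨rfl, rfl⟩ := Prod.mk.inj h
    exact ⟨hx, hy⟩
  · exact fun h => Part.mem_bind h.1 (Part.mem_map _ h.2)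

theorem mem_sum_rep_inl {X Y : RepSpace} {p : Baire} {x : X.carrier} :
    (Sum.inl x : X.carrier ⊕ Y.carrier) ∈ (X.sum Y).rep p ↔
      p 0 = 0 ∧ x ∈ X.rep (tail p) := by
  change _ ∈ (if p 0 = 0 then (X.rep (tail p)).map Sum.inl
    else if p 0 = 1 then (Y.rep (tail p)).map Sum.inr else Part.none) ↔ _
  split_ifs with h h'
  · simp [h]
  · simp [h]
  · simp [h]

theorem mem_sum_rep_inr {X Y : RepSpace} {p : Baire} {y : Y.carrier} :
    (Sum.inr y : X.carrier ⊕ Y.carrier) ∈ (X.sum Y).rep p ↔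
      p 0 = 1 ∧ y ∈ Y.rep (tail p) := by
  change _ ∈ (if p 0 = 0 then (X.rep (tail p)).map Sum.inl
    else if p 0 = 1 then (Y.rep (tail p)).map Sum.inr else Part.none) ↔ _
  split_ifs with h h'
  · simp [h]
  · simp [h']
  · simp [h']

theorem names_one : names Problem.one = oneN := by
  ext p q
  exact ⟨fun _ => trivial, fun _ => ⟨(), Part.mem_some _, (), Part.mem_some _, rfl⟩⟩

theorem names_prod (f g : Problem) : names (f.prod g) = prodN (names f) (names g) := by
  ext p w
  constructor
  · rintro ⟨z, hz, y, hy, h1, h2⟩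
    have hz := mem_prod_rep.1 hz
    have hy := mem_prod_rep.1 hy
    exact ⟨⟨_, hz.1, _, hy.1, h1⟩, ⟨_, hz.2, _, hy.2, h2⟩⟩
  · rintro ⟨⟨x, hx, y, hy, h⟩, ⟨x', hx', y', hy', h'⟩⟩
    exact ⟨(x, x'), mem_prod_rep.2 ⟨hx, hx'⟩, (y, y'), mem_prod_rep.2 ⟨hy, hy'⟩, h, h'⟩

theorem names_meet (f g : Problem) : names (f.meet g) = meetN (names f) (names g) := by
  ext p w
  constructor
  · rintro ⟨z, hz, y, hy, h1, h2, h⟩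
    have hz := mem_prod_rep.1 hz
    refine ⟨mem_dom_names.2 ⟨_, hz.1, h1⟩, mem_dom_names.2 ⟨_, hz.2, h2⟩, ?_⟩
    rcases h with ⟨v, hv, rfl⟩ | ⟨v, hv, rfl⟩
    · have hy := mem_sum_rep_inl.1 hy
      exact Or.inl ⟨hy.1, _, hz.1, v, hy.2, hv⟩
    · have hy := mem_sum_rep_inr.1 hy
      exact Or.inr ⟨hy.1, _, hz.2, v, hy.2, hv⟩
  · rintro ⟨h1, h2, h⟩
    obtain ⟨x, hx, h1⟩ := mem_dom_names.1 h1
    obtain ⟨y, hy, h2⟩ := mem_dom_names.1 h2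
    refine ⟨(x, y), mem_prod_rep.2 ⟨hx, hy⟩, ?_⟩
    rcases h with ⟨h0, h⟩ | ⟨h0, h⟩
    · obtain ⟨v, hv, h⟩ := (mem_names hx).1 h
      exact ⟨Sum.inl v, mem_sum_rep_inl.2 ⟨h0, hv⟩, h1, h2, Or.inl ⟨v, h, rfl⟩⟩
    · obtain ⟨v, hv, h⟩ := (mem_names hy).1 h
      exact ⟨Sum.inr v, mem_sum_rep_inr.2 ⟨h0, hv⟩, h1, h2, Or.inr ⟨v, h, rfl⟩⟩

theorem names_join (f g : Problem) : names (f.join g) = joinN (names f) (names g) := by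
  ext p w
  constructor
  · rintro ⟨x | x, hx, y, hy, v, hv, rfl⟩
    · have hx := mem_sum_rep_inl.1 hx
      have hy := mem_sum_rep_inl.1 hy
      exact Or.inl ⟨hx.1, hy.1, x, hx.2, v, hy.2, hv⟩
    · have hx := mem_sum_rep_inr.1 hx
      have hy := mem_sum_rep_inr.1 hy
      exact Or.inr ⟨hx.1, hy.1, x, hx.2, v, hy.2, hv⟩
  · rintro (⟨h, h', x, hx, v, hv, hf⟩ | ⟨h, h', x, hx, v, hv, hf⟩)
    · exact ⟨Sum.inl x, mem_sum_rep_inl.2 ⟨h, hx⟩, Sum.inl v, mem_sum_rep_inl.2 ⟨h', hv⟩,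
        v, hf, rfl⟩
    · exact ⟨Sum.inr x, mem_sum_rep_inr.2 ⟨h, hx⟩, Sum.inr v, mem_sum_rep_inr.2 ⟨h', hv⟩,
        v, hf, rfl⟩

theorem mem_dom_PhiMV {X Y : RepSpace} {e : Baire} {x : X.carrier} :
    x ∈ (PhiMV X Y e).dom ↔
      ∀ q r, x ∈ X.rep q → ∃ s ∈ Phi e (pr q r), (Y.rep s).Dom := by
  refine ⟨fun ⟨y, h, _⟩ => h, fun h => ?_⟩
  obtain ⟨q, hq⟩ := X.surj x
  obtain ⟨s, hs, hd⟩ := h q q hq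
  exact ⟨(Y.rep s).get hd, h, q, q, hq, s, hs, Part.get_mem hd⟩

/-- The names of all values of `g` at `x` are exactly the members of `names g p`, so quantifying
over values and then over their names is quantifying over solutions. -/
theorem mem_comp_PhiMV {g : Problem} {U : RepSpace} {e p : Baire} {x : g.src.carrier}
    (hx : x ∈ g.src.rep p) {z : U.carrier} : z ∈ MV.comp (PhiMV g.tgt U e) g.fn x ↔
      (∀ q ∈ names g p, ∀ r, ∃ s ∈ Phi e (pr q r), (U.rep s).Dom) ∧
        ∃ q ∈ names g p, ∃ r, ∃ s ∈ Phi e (pr q r), z ∈ U.rep s := by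
  constructor
  · rintro ⟨h, y, hy, -, q, r, hq, hs⟩
    refine ⟨fun q hq r => ?_, q, (mem_names hx).2 ⟨y, hq, hy⟩, r, hs⟩
    obtain ⟨y, hy, hyg⟩ := (mem_names hx).1 hq
    exact mem_dom_PhiMV.1 (h y hyg) q r hy
  · rintro ⟨h, q, hq, r, hs⟩
    have hd : ∀ y ∈ g.fn x, y ∈ (PhiMV g.tgt U e).dom := fun y hy =>
      mem_dom_PhiMV.2 fun q r hq => h q ((mem_names hx).2 ⟨y, hq, hy⟩) r
    obtain ⟨y, hy, hyg⟩ := (mem_names hx).1 hq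
    exact ⟨hd, y, hyg, mem_dom_PhiMV.1 (hd y hyg), q, r, hy, hs⟩

theorem names_star (f g : Problem) : names (f.star g) = starN (names f) (names g) := by
  ext p w
  constructor
  · rintro ⟨⟨h, x⟩, hz, ⟨a, v⟩, hy, hall, ⟨b, u⟩, ht, hbv⟩
    obtain ⟨hh, hx⟩ := mem_prod_rep.1 hz
    obtain ⟨ha, hv⟩ := mem_prod_rep.1 hy
    cases Part.mem_some_iff.1 hh
    cases Part.mem_some_iff.1 ha
    have ht' := (mem_comp_PhiMV hx).1 ht
    refine ⟨fun q hq r => ?_, ?_⟩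
    · obtain ⟨s, hs, hd⟩ := ht'.1 q hq r
      obtain ⟨m, hm⟩ := Part.dom_iff_mem.1 hd
      obtain ⟨⟨c, d⟩, -, hcd⟩ := hall m ((mem_comp_PhiMV hx).2 ⟨ht'.1, q, hq, r, s, hs, hm⟩)
      exact ⟨s, hs, mem_dom_names.2 ⟨m.2, (mem_prod_rep.1 hm).2, d, hcd⟩⟩
    · obtain ⟨-, q, hq, r, s, hs, hm⟩ := ht'
      obtain ⟨hb, hu⟩ := mem_prod_rep.1 hm
      cases Part.mem_some_iff.1 hb
      exact ⟨q, hq, r, s, hs, hbv.1, u, hu, v, hv, hbv.2⟩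
  · rintro ⟨hall, q, hq, r, t, ht, hw, u, hu, v, hv, huv⟩
    obtain ⟨x, hx, -⟩ := id hq
    have hd : ∀ q ∈ names g (odds p), ∀ r, ∃ s ∈ Phi (evens p) (pr q r),
        ((RepSpace.baire.prod f.src).rep s).Dom := fun q hq r => by
      obtain ⟨s, hs, hsd⟩ := hall q hq r
      obtain ⟨u, hu, -⟩ := mem_dom_names.1 hsd
      exact ⟨s, hs, Part.dom_iff_mem.2
        ⟨(evens s, u), mem_prod_rep.2 ⟨Part.mem_some _, hu⟩⟩⟩
    refine ⟨(⟨PhiMV g.tgt (RepSpace.baire.prod f.src) (evens p), evens p, rfl⟩, x),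
      mem_prod_rep.2 ⟨Part.mem_some _, hx⟩, (evens w, v),
      mem_prod_rep.2 ⟨Part.mem_some _, hv⟩, fun m hm => ?_, (evens t, u),
      (mem_comp_PhiMV hx).2 ⟨hd, q, hq, r, t, ht, mem_prod_rep.2 ⟨Part.mem_some _, hu⟩⟩,
      hw, huv⟩
    obtain ⟨-, q, hq, r, s, hs, hms⟩ := (mem_comp_PhiMV hx).1 hm
    obtain ⟨s', hs', hsd⟩ := hall q hq r
    cases Part.mem_unique hs hs'
    obtain ⟨n, hn⟩ := (mem_dom_names_of_mem (mem_prod_rep.1 hms).2).1 hsd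
    exact ⟨(m.1, n), rfl, hn⟩

theorem names_impCore (g f : Problem) : names (g.impCore f) = impN (names g) (names f) := by
  ext p w
  constructor
  · rintro ⟨x, hx, ⟨h, y⟩, hz, ⟨t, ht⟩, hsub⟩
    obtain ⟨hh, hy⟩ := mem_prod_rep.1 hz
    cases Part.mem_some_iff.1 hh
    obtain ⟨hd, q, hq, -⟩ := (mem_comp_PhiMV hy).1 ht
    refine ⟨⟨q, hq⟩, fun q hq r => ?_⟩
    obtain ⟨s, hs, hsd⟩ := hd q hq r
    obtain ⟨m, hm⟩ := Part.dom_iff_mem.1 hsd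
    exact ⟨s, hs, x, hx, m, hm, hsub ((mem_comp_PhiMV hy).2 ⟨hd, q, hq, r, s, hs, hm⟩)⟩
  · rintro ⟨⟨q, hq⟩, h⟩
    obtain ⟨y, hy, -⟩ := id hq
    obtain ⟨t, ht, x, hx, v, hv, hvx⟩ := h q hq fun _ => 0
    have hd : ∀ q ∈ names g (odds w), ∀ r, ∃ s ∈ Phi (evens w) (pr q r),
        (f.tgt.rep s).Dom := fun q hq r => by
      obtain ⟨s, hs, -, -, m, hm, -⟩ := h q hq r
      exact ⟨s, hs, Part.dom_iff_mem.2 ⟨m, hm⟩⟩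
    refine ⟨x, hx, (⟨PhiMV g.tgt f.tgt (evens w), evens w, rfl⟩, y),
      mem_prod_rep.2 ⟨Part.mem_some _, hy⟩,
      ⟨v, (mem_comp_PhiMV hy).2 ⟨hd, q, hq, _, t, ht, hv⟩⟩, fun m hm => ?_⟩
    obtain ⟨-, q, hq, r, s, hs, hms⟩ := (mem_comp_PhiMV hy).1 hm
    obtain ⟨s', hs', hn⟩ := h q hq r
    cases Part.mem_unique hs hs'
    obtain ⟨m', hm', hf⟩ := (mem_names hx).1 hn
    rwa [Part.mem_unique hms hm']

/-! ### The operations with the top element -/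

theorem red_prod_self (f : MV Baire Baire) : Red f (prodN f f) := by
  refine ⟨fun p => pr p p, fun c => evens (odds c), CompOn.id.pr .id, fun p hp => ?_,
    CompOn.id.odds.evens, fun c hc => ?_⟩
  · rw [mem_dom_prodN, evens_pr, odds_pr]
    exact ⟨hp, hp⟩
  · have h := hc.2.1
    rwa [evens_pr] at h

namespace ExtProblem

theorem fin_le_fin {f g : Problem} : fin f ≤ fin g ↔ Red (names f) (names g) :=
  wReducible_iff_red

theorem le_infty (a : ExtProblem) : a ≤ infty := by
  cases a <;> trivial

theorem not_infty_le_fin {f : Problem} : ¬ infty ≤ fin f := id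

theorem star_mono {a a' b b' : ExtProblem} (ha : a ≤ a') (hb : b ≤ b') :
    a.star b ≤ a'.star b' := by
  rcases a' with f' | _
  · rcases b' with g' | _
    · rcases a with f | _
      · rcases b with g | _
        · rw [fin_le_fin] at ha hb
          refine fin_le_fin.2 ?_
          rw [names_star, names_star]
          exact ha.star_mono hb
        · exact (not_infty_le_fin hb).elim
      · exact (not_infty_le_fin ha).elim
    · exact le_infty _
  · exact le_infty _

theorem star_assoc_le (a b c : ExtProblem) : (a.star b).star c ≤ a.star (b.star c) := by
  rcases a with f | _
  · rcases b with g | _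
    · rcases c with h | _
      · refine fin_le_fin.2 ?_
        simp only [names_star]
        exact (Red.refl _).star_assoc
      · exact le_infty _
    · exact le_infty _
  · exact le_infty _

theorem le_star_assoc (a b c : ExtProblem) : a.star (b.star c) ≤ (a.star b).star c := by
  rcases a with f | _
  · rcases b with g | _
    · rcases c with h | _
      · refine fin_le_fin.2 ?_
        simp only [names_star]
        exact (Red.refl _).star_assoc_symm
      · exact le_infty _
    · exact le_infty _
  · exact le_infty _

theorem le_star_one (a : ExtProblem) : a ≤ a.star (fin Problem.one) := by
  rcases a with f | _
  · refine fin_le_fin.2 ?_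
    rw [names_star, names_one]
    exact red_star_one _
  · exact le_infty _

theorem prod_mono {a a' b b' : ExtProblem} (ha : a ≤ a') (hb : b ≤ b') :
    a.prod b ≤ a'.prod b' := by
  rcases a' with f' | _
  · rcases b' with g' | _
    · rcases a with f | _
      · rcases b with g | _
        · rw [fin_le_fin] at ha hb
          refine fin_le_fin.2 ?_
          rw [names_prod, names_prod]
          exact ha.prod_mono hb
        · exact (not_infty_le_fin hb).elim
      · exact (not_infty_le_fin ha).elim
    · exact le_infty _
  · exact le_infty _

theorem prod_le_star (a b : ExtProblem) : a.prod b ≤ a.star b := by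
  rcases a with f | _
  · rcases b with g | _
    · refine fin_le_fin.2 ?_
      rw [names_star, names_prod]
      exact red_prod_star _ _
    · exact le_infty _
  · exact le_infty _

theorem prod_star_le (a b c d : ExtProblem) :
    (a.star c).prod (b.star d) ≤ (a.prod b).star (c.prod d) := by
  rcases a with f | _
  · rcases b with g | _
    · rcases c with h | _
      · rcases d with k | _
        · refine fin_le_fin.2 ?_
          simp only [names_star, names_prod]
          exact (Red.refl _).prod_star (Red.refl _)
        · exact le_infty _
      · exact le_infty _
    · exact le_infty _
  · exact le_infty _

theorem le_prod_self (a : ExtProblem) : a ≤ a.prod a := by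
  rcases a with f | _
  · refine fin_le_fin.2 ?_
    rw [names_prod]
    exact red_prod_self _
  · exact le_infty _

theorem meet_le_left (a b : ExtProblem) : a.meet b ≤ a := by
  rcases a with f | _
  · rcases b with g | _
    · refine fin_le_fin.2 ?_
      rw [names_meet]
      exact red_meet_left _ _
    · exact le_refl (fin f)
  · exact le_infty _

theorem meet_le_right (a b : ExtProblem) : a.meet b ≤ b := by
  rcases b with g | _
  · rcases a with f | _
    · refine fin_le_fin.2 ?_
      rw [names_meet]
      exact red_meet_right _ _
    · exact le_refl (fin g)
  · exact le_infty _

theorem le_meet {a b k : ExtProblem} (ha : k ≤ a) (hb : k ≤ b) : k ≤ a.meet b := by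
  rcases a with f | _
  · rcases b with g | _
    · rcases k with k | _
      · rw [fin_le_fin] at ha hb
        refine fin_le_fin.2 ?_
        rw [names_meet]
        exact ha.le_meet hb
      · exact (not_infty_le_fin ha).elim
    · exact ha
  · exact hb

/-- If one factor is `∞`, the meet is the other factor, and `c ≤ c × c` suffices. -/
theorem le_meet_star {a b c k : ExtProblem} (ha : k ≤ a.star c) (hb : k ≤ b.star c) :
    k ≤ (a.meet b).star (c.prod c) := by
  rcases a with f | _
  · rcases b with g | _
    · rcases c with h | _
      · rcases k with k | _
        · have ha := fin_le_fin.1 ha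
          have hb := fin_le_fin.1 hb
          rw [names_star] at ha hb
          refine fin_le_fin.2 ?_
          rw [names_star, names_meet, names_prod]
          exact ha.meet_star hb
        · exact (not_infty_le_fin ha).elim
      · exact le_infty _
    · exact ha.trans (star_mono (le_refl _) (le_prod_self c))
  · exact hb.trans (star_mono (le_refl _) (le_prod_self c))

theorem le_join_left (a b : ExtProblem) : a ≤ a.join b := by
  rcases a with f | _
  · rcases b with g | _
    · refine fin_le_fin.2 ?_
      rw [names_join]
      exact red_left_join _ _
    · exact le_infty _
  · exact le_infty _

theorem le_join_right (a b : ExtProblem) : b ≤ a.join b := by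
  rcases a with f | _
  · rcases b with g | _
    · refine fin_le_fin.2 ?_
      rw [names_join]
      exact red_right_join _ _
    · exact le_infty _
  · exact le_infty _

theorem join_le {a b k : ExtProblem} (ha : a ≤ k) (hb : b ≤ k) : a.join b ≤ k := by
  rcases a with f | _
  · rcases b with g | _
    · rcases k with k | _
      · rw [fin_le_fin] at ha hb
        refine fin_le_fin.2 ?_
        rw [names_join]
        exact ha.join_le hb
      · exact le_infty _
    · exact hb
  · exact ha

theorem dom_names_nonempty {f : Problem} : (names f).dom.Nonempty ↔ f.fn.dom.Nonempty := by
  constructor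
  · rintro ⟨p, hp⟩
    obtain ⟨x, -, hx⟩ := mem_dom_names.1 hp
    exact ⟨x, hx⟩
  · rintro ⟨x, hx⟩
    obtain ⟨p, hp⟩ := f.src.surj x
    exact ⟨p, mem_dom_names.2 ⟨x, hp, hx⟩⟩

theorem dom_names_eq_empty {f : Problem} : (names f).dom = ∅ ↔ f.fn.dom = ∅ := by
  rw [← Set.not_nonempty_iff_eq_empty, dom_names_nonempty, Set.not_nonempty_iff_eq_empty]

theorem zero_le (a : ExtProblem) : fin Problem.zero ≤ a := by
  rcases a with g | _
  · have h : ∀ p, p ∉ (names Problem.zero).dom := by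
      rintro p ⟨_, _, _, _, _, h⟩
      exact h
    exact fin_le_fin.2 (.of_map (fun p => p) .id (fun p hp => (h p hp).elim)
      fun p hp => (h p hp).elim)
  · exact le_infty _

/-- The conventions for `∞` are the ones that residuation dictates. In particular, if `g` is nowhere
defined then so is `g ⋆ x` for finite `x`, so a problem `f` with an instance is below it only for `x
= ∞`. -/
theorem imp_le_iff {a b x : ExtProblem} : a.imp b ≤ x ↔ b ≤ a.star x := by
  rcases a with g | _
  · rcases x with x | _
    · rcases b with f | _
      · rw [star, fin_le_fin, names_star]
        by_cases h : g.fn.dom.Nonempty ∨ f.fn.dom = ∅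
        · rw [imp, if_pos h, fin_le_fin, names_impCore, red_imp_iff]
          rwa [dom_names_nonempty, dom_names_eq_empty]
        · rw [imp, if_neg h]
          refine iff_of_false not_infty_le_fin fun hr => h ?_
          rw [← dom_names_nonempty, ← dom_names_eq_empty]
          by_contra! hn
          obtain ⟨p, hp⟩ := hn.2
          obtain ⟨H, -, -, hd, -⟩ := hr
          obtain ⟨w, -, q, -, r, t, -, -, hw⟩ := hd p hp
          have ht : odds t ∈ (names g).dom := ⟨_, hw⟩
          rw [hn.1] at ht
          exact ht
      · exact iff_of_false not_infty_le_fin not_infty_le_fin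
    · exact iff_of_true (le_infty _) (le_infty _)
  · exact iff_of_true (zero_le x) (le_infty _)

theorem imp_mono {a a' b b' : ExtProblem} (ha : a ≤ a') (hb : b ≤ b') :
    a'.imp b ≤ a.imp b' :=
  imp_le_iff.2 ((hb.trans (imp_le_iff.1 (le_refl _))).trans (star_mono ha (le_refl _)))

end ExtProblem

/-! ### The operations on degrees -/

theorem deg_le_deg {f g : ExtProblem} : deg f ≤ deg g ↔ f ≤ g :=
  toAntisymmetrization_le_toAntisymmetrization_iff

theorem rp_deg_le (f : ExtProblem) : rp (deg f) ≤ f :=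
  deg_le_deg.1 (deg_rp _).le

theorem le_rp_deg (f : ExtProblem) : f ≤ rp (deg f) :=
  deg_le_deg.1 (deg_rp _).ge

theorem rp_le_rp {a b : Degree} : rp a ≤ rp b ↔ a ≤ b := by
  rw [← deg_le_deg, deg_rp, deg_rp]

/-- Independence of representatives follows from the universal property, here and for joins; for the
other operations it follows from monotonicity. -/
theorem dMeet_deg (f g : ExtProblem) : dMeet (deg f) (deg g) = deg (f.meet g) :=
  le_antisymm
    (deg_le_deg.2 (ExtProblem.le_meet ((ExtProblem.meet_le_left _ _).trans (rp_deg_le f))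
      ((ExtProblem.meet_le_right _ _).trans (rp_deg_le g))))
    (deg_le_deg.2 (ExtProblem.le_meet ((ExtProblem.meet_le_left _ _).trans (le_rp_deg f))
      ((ExtProblem.meet_le_right _ _).trans (le_rp_deg g))))

theorem dJoin_deg (f g : ExtProblem) : dJoin (deg f) (deg g) = deg (f.join g) :=
  le_antisymm
    (deg_le_deg.2 (ExtProblem.join_le ((rp_deg_le f).trans (ExtProblem.le_join_left _ _))
      ((rp_deg_le g).trans (ExtProblem.le_join_right _ _))))
    (deg_le_deg.2 (ExtProblem.join_le ((le_rp_deg f).trans (ExtProblem.le_join_left _ _))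
      ((le_rp_deg g).trans (ExtProblem.le_join_right _ _))))

theorem dProd_deg (f g : ExtProblem) : dProd (deg f) (deg g) = deg (f.prod g) :=
  le_antisymm (deg_le_deg.2 (ExtProblem.prod_mono (rp_deg_le f) (rp_deg_le g)))
    (deg_le_deg.2 (ExtProblem.prod_mono (le_rp_deg f) (le_rp_deg g)))

theorem dStar_deg (f g : ExtProblem) : dStar (deg f) (deg g) = deg (f.star g) :=
  le_antisymm (deg_le_deg.2 (ExtProblem.star_mono (rp_deg_le f) (rp_deg_le g)))
    (deg_le_deg.2 (ExtProblem.star_mono (le_rp_deg f) (le_rp_deg g)))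

theorem dImp_deg (f g : ExtProblem) : dImp (deg f) (deg g) = deg (f.imp g) :=
  le_antisymm (deg_le_deg.2 (ExtProblem.imp_mono (le_rp_deg f) (rp_deg_le g)))
    (deg_le_deg.2 (ExtProblem.imp_mono (rp_deg_le f) (le_rp_deg g)))

theorem dStar_mono {a a' b b' : Degree} (ha : a ≤ a') (hb : b ≤ b') :
    dStar a b ≤ dStar a' b' :=
  deg_le_deg.2 (ExtProblem.star_mono (rp_le_rp.2 ha) (rp_le_rp.2 hb))

theorem dStar_assoc (a b c : Degree) : dStar (dStar a b) c = dStar a (dStar b c) := by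
  rw [← deg_rp a, ← deg_rp b, ← deg_rp c]
  simp only [dStar_deg]
  exact le_antisymm (deg_le_deg.2 (ExtProblem.star_assoc_le _ _ _))
    (deg_le_deg.2 (ExtProblem.le_star_assoc _ _ _))

theorem le_dStar_one (a : Degree) : a ≤ dStar a dOne := by
  rw [← deg_rp a, dOne, dStar_deg]
  exact deg_le_deg.2 (ExtProblem.le_star_one _)

theorem dProd_mono {a a' b b' : Degree} (ha : a ≤ a') (hb : b ≤ b') :
    dProd a b ≤ dProd a' b' :=
  deg_le_deg.2 (ExtProblem.prod_mono (rp_le_rp.2 ha) (rp_le_rp.2 hb))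

theorem dProd_le_dStar (a b : Degree) : dProd a b ≤ dStar a b :=
  deg_le_deg.2 (ExtProblem.prod_le_star _ _)

theorem dProd_dStar_le (a b c d : Degree) :
    dProd (dStar a c) (dStar b d) ≤ dStar (dProd a b) (dProd c d) := by
  rw [← deg_rp a, ← deg_rp b, ← deg_rp c, ← deg_rp d]
  simp only [dStar_deg, dProd_deg]
  exact deg_le_deg.2 (ExtProblem.prod_star_le _ _ _ _)

theorem dMeet_le_left (a b : Degree) : dMeet a b ≤ a :=
  (deg_le_deg.2 (ExtProblem.meet_le_left _ _)).trans_eq (deg_rp a)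

theorem dMeet_le_right (a b : Degree) : dMeet a b ≤ b :=
  (deg_le_deg.2 (ExtProblem.meet_le_right _ _)).trans_eq (deg_rp b)

theorem le_dMeet_dStar {a b c k : Degree} (ha : k ≤ dStar a c) (hb : k ≤ dStar b c) :
    k ≤ dStar (dMeet a b) (dProd c c) := by
  rw [← deg_rp a, ← deg_rp c, ← deg_rp k, dStar_deg, deg_le_deg] at ha
  rw [← deg_rp b, ← deg_rp c, ← deg_rp k, dStar_deg, deg_le_deg] at hb
  rw [← deg_rp a, ← deg_rp b, ← deg_rp c, ← deg_rp k, dMeet_deg, dProd_deg, dStar_deg,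
    deg_le_deg]
  exact ExtProblem.le_meet_star ha hb

theorem le_dJoin_left (a b : Degree) : a ≤ dJoin a b :=
  (deg_rp a).ge.trans (deg_le_deg.2 (ExtProblem.le_join_left _ _))

theorem le_dJoin_right (a b : Degree) : b ≤ dJoin a b :=
  (deg_rp b).ge.trans (deg_le_deg.2 (ExtProblem.le_join_right _ _))

theorem dJoin_le {a b k : Degree} (ha : a ≤ k) (hb : b ≤ k) : dJoin a b ≤ k :=
  (deg_le_deg.2 (ExtProblem.join_le (rp_le_rp.2 ha) (rp_le_rp.2 hb))).trans_eq (deg_rp k)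

theorem dImp_le_iff {a b x : Degree} : dImp a b ≤ x ↔ b ≤ dStar a x := by
  rw [← deg_rp a, ← deg_rp b, ← deg_rp x, dImp_deg, dStar_deg, deg_le_deg, deg_le_deg]
  exact ExtProblem.imp_le_iff

/-! ### Reducibility relative to a preideal -/

/-- Advice may be taken from the downwards closure, where the ideal axioms are available. -/
theorem leMod_iff {A : Set Degree} {a b : Degree} :
    LeMod A a b ↔ ∃ c ∈ lowerClosure A, a ≤ dStar b c := by
  constructor
  · rintro ⟨c, hc, h⟩
    exact ⟨c, subset_lowerClosure hc, h⟩
  · rintro ⟨c, ⟨d, hd, hcd⟩, h⟩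
    exact ⟨d, hd, h.trans (dStar_mono le_rfl hcd)⟩

namespace IsStarPreideal

theorem leMod_of_le {A : Set Degree} (hA : IsStarPreideal A) {a b : Degree} (h : a ≤ b) :
    LeMod A a b :=
  leMod_iff.2 ⟨dOne, hA.one_mem, h.trans (le_dStar_one b)⟩

theorem leMod_trans {A : Set Degree} (hA : IsStarPreideal A) {a b c : Degree}
    (hab : LeMod A a b) (hbc : LeMod A b c) : LeMod A a c := by
  obtain ⟨d, hd, hab⟩ := leMod_iff.1 hab
  obtain ⟨e, he, hbc⟩ := leMod_iff.1 hbc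
  refine leMod_iff.2 ⟨dStar e d, hA.star_mem e he d hd, hab.trans ?_⟩
  rw [← dStar_assoc]
  exact dStar_mono hbc le_rfl

theorem isPreorder {A : Set Degree} (hA : IsStarPreideal A) : IsPreorder Degree (LeMod A) where
  refl a := hA.leMod_of_le (le_refl a)
  trans _ _ _ := hA.leMod_trans

/-- Closure under `×` comes for free, because `×` is below `⋆`. -/
theorem dProd_mem {A : Set Degree} (hA : IsStarPreideal A) {c d : Degree}
    (hc : c ∈ lowerClosure A) (hd : d ∈ lowerClosure A) : dProd c d ∈ lowerClosure A :=
  hA.lower _ (hA.star_mem c hc d hd) _ (dProd_le_dStar c d)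

theorem leMod_dMeet {A : Set Degree} (hA : IsStarPreideal A) {a b k : Degree}
    (ha : LeMod A k a) (hb : LeMod A k b) : LeMod A k (dMeet a b) := by
  obtain ⟨c, hc, ha⟩ := leMod_iff.1 ha
  obtain ⟨d, hd, hb⟩ := leMod_iff.1 hb
  -- The join serves as common advice for both reductions, as `le_dMeet_dStar` requires.
  have he := hA.join_mem c hc d hd
  exact leMod_iff.2 ⟨_, hA.dProd_mem he he, le_dMeet_dStar
    (ha.trans (dStar_mono le_rfl (le_dJoin_left c d)))
    (hb.trans (dStar_mono le_rfl (le_dJoin_right c d)))⟩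

theorem dJoin_leMod {A : Set Degree} (hA : IsStarPreideal A) {a b k : Degree}
    (ha : LeMod A a k) (hb : LeMod A b k) : LeMod A (dJoin a b) k := by
  obtain ⟨c, hc, ha⟩ := leMod_iff.1 ha
  obtain ⟨d, hd, hb⟩ := leMod_iff.1 hb
  exact leMod_iff.2 ⟨_, hA.join_mem c hc d hd, dJoin_le
    (ha.trans (dStar_mono le_rfl (le_dJoin_left c d)))
    (hb.trans (dStar_mono le_rfl (le_dJoin_right c d)))⟩

theorem leMod_dProd {A : Set Degree} (hA : IsStarPreideal A) {a a' b b' : Degree}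
    (ha : LeMod A a a') (hb : LeMod A b b') : LeMod A (dProd a b) (dProd a' b') := by
  obtain ⟨c, hc, ha⟩ := leMod_iff.1 ha
  obtain ⟨d, hd, hb⟩ := leMod_iff.1 hb
  exact leMod_iff.2 ⟨_, hA.dProd_mem hc hd, (dProd_mono ha hb).trans (dProd_dStar_le _ _ _ _)⟩

theorem leMod_dStar {A : Set Degree} (hA : IsStarPreideal A) (he : IsEtheric A)
    {a a' b b' : Degree} (ha : LeMod A a a') (hb : LeMod A b b') :
    LeMod A (dStar a b) (dStar a' b') := by
  obtain ⟨c, hc, ha⟩ := leMod_iff.1 ha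
  obtain ⟨d, hd, hb⟩ := leMod_iff.1 hb
  -- The advice `c` stands between `a'` and `b'`; ethericity moves it past `b'`.
  obtain ⟨c', hc', h⟩ := he c hc b'
  refine leMod_iff.2 ⟨dStar c' d, hA.star_mem c' hc' d hd, ?_⟩
  calc dStar a b ≤ dStar (dStar a' c) (dStar b' d) := dStar_mono ha hb
    _ = dStar a' (dStar (dStar c b') d) := by simp only [dStar_assoc]
    _ ≤ dStar a' (dStar (dStar b' c') d) := dStar_mono le_rfl (dStar_mono h le_rfl)
    _ = dStar (dStar a' b') (dStar c' d) := by simp only [dStar_assoc]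

theorem leMod_dImp {A : Set Degree} (hA : IsStarPreideal A) (he : IsEtheric A)
    {a a' b b' : Degree} (ha : LeMod A a' a) (hb : LeMod A b b') :
    LeMod A (dImp a b) (dImp a' b') := by
  obtain ⟨c, hc, ha⟩ := leMod_iff.1 ha
  obtain ⟨d, hd, hb⟩ := leMod_iff.1 hb
  -- After residuation the advice `c`, spent on reducing `a'` to `a`, stands to the left of `a' →
  -- b'` and has to pass it.
  obtain ⟨c', hc', h⟩ := he c hc (dImp a' b')
  refine leMod_iff.2 ⟨dStar c' d, hA.star_mem c' hc' d hd, dImp_le_iff.2 ?_⟩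
  calc b ≤ dStar b' d := hb
    _ ≤ dStar (dStar a' (dImp a' b')) d := dStar_mono (dImp_le_iff.1 le_rfl) le_rfl
    _ ≤ dStar (dStar (dStar a c) (dImp a' b')) d :=
      dStar_mono (dStar_mono ha le_rfl) le_rfl
    _ = dStar a (dStar (dStar c (dImp a' b')) d) := by simp only [dStar_assoc]
    _ ≤ dStar a (dStar (dStar (dImp a' b') c') d) := dStar_mono le_rfl (dStar_mono h le_rfl)
    _ = dStar a (dStar (dImp a' b') (dStar c' d)) := by simp only [dStar_assoc]

end IsStarPreideal

/-! ### Induced operations and lattice structure on the quotient -/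

theorem toAntisymmetrization_eq_iff {α : Type*} {r : α → α → Prop} [IsPreorder α r] {a b : α} :
    toAntisymmetrization r a = toAntisymmetrization r b ↔ r a b ∧ r b a :=
  Quotient.eq

/-- An operation that respects the equivalence relation of a preorder induces an operation
on the equivalence classes. -/
theorem exists_induces {r : Degree → Degree → Prop} [IsPreorder Degree r]
    {op : Degree → Degree → Degree}
    (h : ∀ a a' b b', r a a' → r a' a → r b b' → r b' b → r (op a b) (op a' b')) :
    ∃ op', Induces r op op' :=
  ⟨Quotient.lift₂ (fun a b => toAntisymmetrization r (op a b)) fun a b a' b' ha hb =>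
    toAntisymmetrization_eq_iff.2
      ⟨h a a' b b' ha.1 ha.2 hb.1 hb.2, h a' a b' b ha.2 ha.1 hb.2 hb.1⟩, fun _ _ => rfl⟩

/-- The equivalence classes of a preorder with infima and suprema of pairs form a lattice. -/
theorem exists_lattice {r : Degree → Degree → Prop} [IsPreorder Degree r]
    {inf sup : Degree → Degree → Degree}
    (inf_left : ∀ a b, r (inf a b) a) (inf_right : ∀ a b, r (inf a b) b)
    (le_inf : ∀ a b k, r k a → r k b → r k (inf a b))
    (left_sup : ∀ a b, r a (sup a b)) (right_sup : ∀ a b, r b (sup a b))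
    (sup_le : ∀ a b k, r a k → r b k → r (sup a b) k) :
    ∃ _ : Lattice (Antisymmetrization Degree r),
      (∀ a b, toAntisymmetrization r a ≤ toAntisymmetrization r b ↔ r a b) ∧
      Induces r inf (fun x y => x ⊓ y) ∧ Induces r sup (fun x y => x ⊔ y) := by
  have tr : ∀ {a b c}, r a b → r b c → r a c := fun h h' => _root_.trans h h'
  let L : Lattice (Antisymmetrization Degree r) :=
    { le := Quotient.lift₂ r fun a b a' b' ha hb =>
        propext ⟨fun h => tr ha.2 (tr h hb.1), fun h => tr ha.1 (tr h hb.2)⟩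
      le_refl := fun x => Quotient.inductionOn x fun a => refl_of r a
      le_trans := fun x y z => Quotient.inductionOn₃ x y z fun a b c => tr
      le_antisymm := fun x y => Quotient.inductionOn₂ x y fun a b h h' =>
        toAntisymmetrization_eq_iff.2 ⟨h, h'⟩
      -- Infima of equivalent pairs are lower bounds of each other's pairs, hence equivalent;
      -- suprema are dual.
      inf := Quotient.map₂ inf fun a a' ha b b' hb =>
        ⟨le_inf _ _ _ (tr (inf_left a b) ha.1) (tr (inf_right a b) hb.1),
          le_inf _ _ _ (tr (inf_left a' b') ha.2) (tr (inf_right a' b') hb.2)⟩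
      sup := Quotient.map₂ sup fun a a' ha b b' hb =>
        ⟨sup_le _ _ _ (tr ha.1 (left_sup a' b')) (tr hb.1 (right_sup a' b')),
          sup_le _ _ _ (tr ha.2 (left_sup a b)) (tr hb.2 (right_sup a b))⟩
      inf_le_left := fun x y => Quotient.inductionOn₂ x y inf_left
      inf_le_right := fun x y => Quotient.inductionOn₂ x y inf_right
      le_inf := fun x y z => Quotient.inductionOn₃ x y z fun k a b => le_inf a b k
      le_sup_left := fun x y => Quotient.inductionOn₂ x y left_sup
      le_sup_right := fun x y => Quotient.inductionOn₂ x y right_sup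
      sup_le := fun x y z => Quotient.inductionOn₃ x y z fun a b k => sup_le a b k }
  exact ⟨L, fun _ _ => Iff.rfl, fun _ _ => rfl, fun _ _ => rfl⟩

end Weihrauch

open Weihrauch in
theorem theorem51 (A : Set Degree) (hA : IsStarPreideal A) :
    ((∀ f g : ExtProblem, dMeet (deg f) (deg g) = deg (f.meet g)) ∧
      (∀ f g : ExtProblem, dJoin (deg f) (deg g) = deg (f.join g)) ∧
      (∀ f g : ExtProblem, dProd (deg f) (deg g) = deg (f.prod g)) ∧
      (∀ f g : ExtProblem, dStar (deg f) (deg g) = deg (f.star g)) ∧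
      (∀ f g : ExtProblem, dImp (deg f) (deg g) = deg (f.imp g))) ∧
    ∃ _ : IsPreorder Degree (LeMod A),
      (∃ L : Lattice (Antisymmetrization Degree (LeMod A)),
        (∀ a b, toAntisymmetrization (LeMod A) a ≤ toAntisymmetrization (LeMod A) b ↔
          LeMod A a b) ∧
        Induces (LeMod A) dMeet (fun x y => x ⊓ y) ∧
        Induces (LeMod A) dJoin (fun x y => x ⊔ y)) ∧
      (∃ op', Induces (LeMod A) dProd op') ∧
      (IsEtheric A →
        (∃ op', Induces (LeMod A) dStar op') ∧
        (∃ op', Induces (LeMod A) dImp op')) := by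
  refine ⟨⟨dMeet_deg, dJoin_deg, dProd_deg, dStar_deg, dImp_deg⟩, hA.isPreorder, ?_⟩
  have := hA.isPreorder
  refine ⟨exists_lattice (fun a b => hA.leMod_of_le (dMeet_le_left a b))
    (fun a b => hA.leMod_of_le (dMeet_le_right a b)) (fun a b k => hA.leMod_dMeet)
    (fun a b => hA.leMod_of_le (le_dJoin_left a b))
    (fun a b => hA.leMod_of_le (le_dJoin_right a b)) (fun a b k => hA.dJoin_leMod),
    exists_induces fun a a' b b' ha _ hb _ => hA.leMod_dProd ha hb, fun he =>
    ⟨exists_induces fun a a' b b' ha _ hb _ => hA.leMod_dStar he ha hb,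
      -- Implication is antitone in its first argument, so the reverse comparison of `a` and `a'` is
      -- used.
      exists_induces fun a a' b b' _ ha hb _ => hA.leMod_dImp he ha hb⟩⟩
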